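/- **Setting.** Let $d\in\mathbb N$, $T>0$, $p\in[1,+\infty)$, $\Gamma_T^p := L^p([0,T];\mathbb R^d)$ with the norm topology and $\Lambda := C([0,T];\mathbb R^d)$ with the topology of uniform convergence. Let $E\colon[0,T]\times\mathbb R^d\to\mathbb R$ satisfy: - (E1) $E\in C^1([0,T]\times\mathbb R^d)$, and $\nabla_x E(t,\cdot)$ is locally Lipschitz continuous on $\mathbb R^d$, uniformly with respect to $t\in[0,T]$; - (E2) there are $C_1,C_2>0$ with $|\partial_t E(t,x)|\le C_1+C_2E(t,x)$ for all $(t,x)\in[0,T]\times\mathbb R^d$; - (E3) there are $C_3,C_4>0$ and $q>1$ with $C_3|x|^q-C_4\le E(t,x)$ for all $(t,x)\in[0,T]\times\mathbb R^d$; - (E4) for every $(t,u)\in[0,T]\times\mathbb R^d$ the set $\{x\in\mathbb R^d:\nabla_xE(t,x)=u\}$ contains only isolated points. Let $f\colon\mathbb R^d\to\mathbb R^d$ satisfy: - (E5) $f$ is locally Lipschitz and $|f(u)|\le C_f(1+|u|)$ for all $u\in\mathbb R^d$, for some constant $C_f$. Let $\eta_0$ be a Borel probability measure with compact support on $\mathbb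 R^d\times\mathbb R^d$. For $\varepsilon>0$ and $(x_0,u_0)\in\mathbb R^d\times\mathbb R^d$ let $Y_\varepsilon(x_0,u_0)=(x_\varepsilon(\cdot),u_\varepsilon(\cdot))\in\Gamma_T^p\times\Lambda$ be the unique solution on $[0,T]$ of $$\varepsilon\dot x(t)=-\nabla_xE(t,x(t))+u(t),\qquad \dot u(t)=f(u(t)),\qquad (x(0),u(0))=(x_0,u_0),$$ and let $$\Pi_\varepsilon:=(\mathrm{id}\times\mathrm{id}\times Y_\varepsilon)_\#\eta_0\in\mathcal P(\mathbb R^d\times\mathbb R^d\times\Gamma_T^p\times\Lambda),$$ that is, $\Pi_\varepsilon$ is the push-forward of $\eta_0$ under $(x_0,u_0)\mapsto(x_0,u_0,x_\varepsilon(\cdot),u_\varepsilon(\cdot))$. **Theorem 3.4.** For every sequence $\varepsilon_n>0$ with $\varepsilon_n\to0$ there exist a subsequence $(\varepsilon_{n_k})_k$ and a measure $\Pi\in\mathcal P(\mathbb R^d\times\mathbb R^d\times\Gamma_T^p\times\Lambda)$ such that $\Pi_{\varepsilon_{n_k}}$ converges narrowly to $\Pi$. Moreover, every accumulation point $\Pi$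 of $\Pi_\varepsilon$ as $\varepsilon\to0^+$, with respect to narrow convergence, satisfies $$\int_{\mathbb R^d\times\mathbb R^d\times\Gamma_T^p\times\Lambda}\int_0^T|\nabla_xE(t,x(t))-u(t)|^2\,dt\,d\Pi(x_0,u_0,x(\cdot),u(\cdot))=0.$$ -/

import Mathlib

open MeasureTheory Set Filter Topology
open scoped ENNReal NNReal Gradient

namespace CriticalEvolution

noncomputable section

/-- Euclidean space `ℝᵈ`. -/
abbrev Vec (d : ℕ) : Type := EuclideanSpace ℝ (Fin d)

/-- The standing assumptions on the energy `E : [0,T] × ℝᵈ → ℝ`. Values of `E` at times outside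
`[0,T]` play no role. -/
structure IsAdmissibleEnergy {d : ℕ} (T : ℝ) (E : ℝ → Vec d → ℝ) : Prop where
  /-- `E` is of class `C¹` on `[0,T] × ℝᵈ`. -/
  contDiffOn : ContDiffOn ℝ 1 (fun q : ℝ × Vec d => E q.1 q.2) (Icc 0 T ×ˢ univ)
  /-- `∇ₓE` is locally Lipschitz in `x`, uniformly in `t ∈ [0,T]`. -/
  lipschitz_gradient : ∀ R : ℝ, ∃ L : ℝ≥0, ∀ t ∈ Icc 0 T,
    LipschitzOnWith L (gradient (E t)) (Metric.closedBall 0 R)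
  /-- `|∂ₜE| ≤ C₁ + C₂ E` on `[0,T] × ℝᵈ`. -/
  power_control : ∃ C₁ C₂ : ℝ, 0 < C₁ ∧ 0 < C₂ ∧ ∀ t ∈ Icc 0 T, ∀ x : Vec d,
    |derivWithin (fun s => E s x) (Icc 0 T) t| ≤ C₁ + C₂ * E t x
  /-- `C₃ |x|^q - C₄ ≤ E` on `[0,T] × ℝᵈ` for some `q > 1`. -/
  coercive : ∃ C₃ C₄ q : ℝ, 0 < C₃ ∧ 0 < C₄ ∧ 1 < q ∧ ∀ t ∈ Icc 0 T, ∀ x : Vec d,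
    C₃ * ‖x‖ ^ q - C₄ ≤ E t x
  /-- The set `{x : ∇ₓE(t,x) = u}` consists of isolated points. -/
  isolated : ∀ t ∈ Icc 0 T, ∀ u x : Vec d, gradient (E t) x = u →
    ∃ δ > 0, ∀ y : Vec d, gradient (E t) y = u → dist y x < δ → y = x

/-- The standing assumptions on the drift `f` of the control: locally Lipschitz with linear
growth. -/
structure IsAdmissibleDrift {d : ℕ} (f : Vec d → Vec d) : Prop where
  locallyLipschitz : LocallyLipschitz f
  linear_growth : ∃ C : ℝ, ∀ u : Vec d, ‖f u‖ ≤ C * (1 + ‖u‖)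

/-- `y = (x, u)` solves `ε x' = -∇ₓE(t,x) + u`, `u' = f(u)` on `[0,T]`, with `y(0) = z`. At the
endpoints of `[0,T]` the derivatives are one-sided. -/
structure IsTrajectory {d : ℕ} (T : ℝ) (E : ℝ → Vec d → ℝ) (f : Vec d → Vec d) (ε : ℝ)
    (z : Vec d × Vec d) (y : ℝ → Vec d × Vec d) : Prop where
  initial : y 0 = z
  hasDeriv : ∀ t ∈ Icc 0 T, HasDerivWithinAt y
    (ε⁻¹ • (-gradient (E t) (y t).1 + (y t).2), f (y t).2) (Icc 0 T) t

open Classical in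
/-- The flow `Y_{ε,t}(z)`: the solution with initial datum `z`, as a function of `t`. Under the
standing assumptions a solution exists for all `ε > 0` and all `z`, and any two agree on `[0,T]`;
the constant curve is a placeholder for the case where no solution exists. -/
def flow {d : ℕ} (T : ℝ) (E : ℝ → Vec d → ℝ) (f : Vec d → Vec d) (ε : ℝ)
    (z : Vec d × Vec d) : ℝ → Vec d × Vec d :=
  if h : ∃ y : ℝ → Vec d × Vec d, IsTrajectory T E f ε z y then h.choose else fun _ => z

theorem continuousOn_flow {d : ℕ} (T : ℝ) (E : ℝ → Vec d → ℝ) (f : Vec d → Vec d) (ε : ℝ)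
    (z : Vec d × Vec d) : ContinuousOn (flow T E f ε z) (Icc 0 T) := by
  unfold flow
  split_ifs with h
  · exact fun t ht => (h.choose_spec.hasDeriv t ht).continuousWithinAt
  · exact continuousOn_const

/-- The space `C([0,T]; ℝᵈ)` with the topology of uniform convergence. -/
abbrev ContCurve (d : ℕ) (T : ℝ) : Type := C(Icc (0 : ℝ) T, Vec d)

/-- Lebesgue measure on `[0,T]`. -/
def timeMeasure (T : ℝ) : Measure (Icc (0 : ℝ) T) := (volume : Measure ℝ).comap Subtype.val

instance (T : ℝ) : IsFiniteMeasure (timeMeasure T) := by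
  refine ⟨?_⟩
  rw [timeMeasure, comap_subtype_coe_apply measurableSet_Icc, image_univ, Subtype.range_coe]
  exact measure_Icc_lt_top

/-- The space `Lᵖ([0,T]; ℝᵈ)`. -/
abbrev LpCurve (d : ℕ) (T : ℝ) (p : ℝ≥0∞) : Type :=
  Lp (Vec d) p (timeMeasure T)

instance (d : ℕ) (T : ℝ) : MeasurableSpace (ContCurve d T) := borel _

instance (d : ℕ) (T : ℝ) : BorelSpace (ContCurve d T) := ⟨rfl⟩

instance (d : ℕ) (T : ℝ) (p : ℝ≥0∞) [Fact (1 ≤ p)] : MeasurableSpace (LpCurve d T p) := borel _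

instance (d : ℕ) (T : ℝ) (p : ℝ≥0∞) [Fact (1 ≤ p)] : BorelSpace (LpCurve d T p) := ⟨rfl⟩

/-- The space `ℝᵈ × ℝᵈ × Lᵖ([0,T]; ℝᵈ) × C([0,T]; ℝᵈ)` of pairs of initial data and curves
`(x₀, u₀, x(·), u(·))`. -/
abbrev PathSpace (d : ℕ) (T : ℝ) (p : ℝ≥0∞) : Type :=
  Vec d × Vec d × LpCurve d T p × ContCurve d T

instance (d : ℕ) (T : ℝ) (p : ℝ≥0∞) [Fact (1 ≤ p)] :
    BorelSpace (LpCurve d T p × ContCurve d T) :=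
  haveI : SecondCountableTopologyEither (LpCurve d T p) (ContCurve d T) := ⟨Or.inr inferInstance⟩
  Prod.borelSpace

instance (d : ℕ) (T : ℝ) (p : ℝ≥0∞) [Fact (1 ≤ p)] :
    BorelSpace (Vec d × LpCurve d T p × ContCurve d T) :=
  haveI : SecondCountableTopologyEither (Vec d) (LpCurve d T p × ContCurve d T) :=
    ⟨Or.inl inferInstance⟩
  Prod.borelSpace

instance (d : ℕ) (T : ℝ) (p : ℝ≥0∞) [Fact (1 ≤ p)] : BorelSpace (PathSpace d T p) :=
  haveI : SecondCountableTopologyEither (Vec d) (Vec d × LpCurve d T p × ContCurve d T) :=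
    ⟨Or.inl inferInstance⟩
  Prod.borelSpace

instance (d : ℕ) (T : ℝ) (p : ℝ≥0∞) [Fact (1 ≤ p)] : OpensMeasurableSpace (PathSpace d T p) :=
  BorelSpace.opensMeasurable

/-- The first component `t ↦ x_ε(t)` of the flow, as a continuous curve on `[0,T]`. -/
def stateCurve {d : ℕ} (T : ℝ) (E : ℝ → Vec d → ℝ) (f : Vec d → Vec d) (ε : ℝ)
    (z : Vec d × Vec d) : ContCurve d T where
  toFun t := (flow T E f ε z t).1
  continuous_toFun :=
    continuous_fst.comp (continuousOn_iff_continuous_domRestrict.1 (continuousOn_flow T E f ε z))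

/-- The second component `t ↦ u_ε(t)` of the flow, as a continuous curve on `[0,T]`. -/
def controlCurve {d : ℕ} (T : ℝ) (E : ℝ → Vec d → ℝ) (f : Vec d → Vec d) (ε : ℝ)
    (z : Vec d × Vec d) : ContCurve d T where
  toFun t := (flow T E f ε z t).2
  continuous_toFun :=
    continuous_snd.comp (continuousOn_iff_continuous_domRestrict.1 (continuousOn_flow T E f ε z))

/-- The map `id × id × Y_ε`, sending `(x₀, u₀)` to `(x₀, u₀, x_ε(·), u_ε(·))`. -/
def liftMap {d : ℕ} (T : ℝ) (p : ℝ≥0∞) [Fact (1 ≤ p)] (E : ℝ → Vec d → ℝ) (f : Vec d → Vec d)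
    (ε : ℝ) (z : Vec d × Vec d) : PathSpace d T p :=
  (z.1, z.2, ContinuousMap.toLp (E := Vec d) p (timeMeasure T) ℝ (stateCurve T E f ε z),
    controlCurve T E f ε z)

/-- The lift `Π_ε = (id × id × Y_ε)_# η₀` of the flow to a measure on initial data and curves. -/
def liftMeasure {d : ℕ} (T : ℝ) (p : ℝ≥0∞) [Fact (1 ≤ p)] (E : ℝ → Vec d → ℝ)
    (f : Vec d → Vec d) (η₀ : Measure (Vec d × Vec d)) (ε : ℝ) : Measure (PathSpace d T p) :=
  η₀.map (liftMap T p E f ε)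

end

end CriticalEvolution

open CriticalEvolution

/-! ### Energy calculus, a priori bounds and the dissipation estimate. -/

namespace CriticalEvolution

variable {d : ℕ} {T : ℝ} {E : ℝ → Vec d → ℝ} {f : Vec d → Vec d}

/-! The tilted energy `E(t,x) - ⟨u,x⟩` has derivative `∂ₜE - ⟨f(u),x⟩ - ε⁻¹|∇ₓE - u|²` along a
trajectory. The singular term has a good sign, so Gronwall and coercivity bound trajectories
uniformly in `ε` (`exists_state_bound`). Integrating the identity then gives `∫|∇ₓE - u|² ≤ Cε`
(`exists_dissipation_bound`).

The main difficulty is compactness of the states in `Lᵖ`, since they have no uniform modulus of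
continuity. The substitute is a Helly-type argument (`exists_subseq_state_tendsto_ae`). The
dissipation `ε⁻¹∫₀ᵗ|∇ₓE - u|²` is monotone in `t` and bounded, so along a subsequence it converges,
together with the states, at all rational times, and its limit jumps at countably many times only.
At almost every other time `t` the force `∇ₓE - u` tends to zero along the subsequence, so cluster
points of the states at `t` are critical, hence isolated. Around such a point `a` the force is at
least some `m > 0` on the annulus of radii `r/2` and `r`. As the speed is `ε⁻¹` times the force,
crossing the annulus costs at least `m r/2` of dissipation (`mul_le_integral_of_crossing`), which is
unavailable near a time without a jump. Thus `a` must be the left limit at `t` of the limit states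
at rational times, and the cluster point is unique (`left_limit_of_mapClusterPt`).

Almost everywhere convergence and uniform bounds give `Lᵖ` convergence; the controls converge
uniformly because their equation does not involve `ε`. So the lifts of a compact set of data along a
vanishing sequence lie in one compact set, and Prokhorov's theorem yields the subsequence. By Fatou
the sublevel sets of the critical defect are closed; they eventually have full measure, so by the
portmanteau theorem every accumulation point gives them full measure too. -/

theorem uniqueDiffOn_timeCylinder (hT : 0 < T) :
    UniqueDiffOn ℝ (Icc 0 T ×ˢ (univ : Set (Vec d))) :=
  (uniqueDiffOn_Icc hT).prod uniqueDiffOn_univ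

namespace IsAdmissibleEnergy

theorem hasFDerivWithinAt (hE : IsAdmissibleEnergy T E) {t : ℝ} (ht : t ∈ Icc 0 T) (x : Vec d) :
    HasFDerivWithinAt (fun q : ℝ × Vec d => E q.1 q.2)
      (fderivWithin ℝ (fun q : ℝ × Vec d => E q.1 q.2) (Icc 0 T ×ˢ univ) (t, x))
      (Icc 0 T ×ˢ univ) (t, x) :=
  (hE.contDiffOn.differentiableOn one_ne_zero (t, x) ⟨ht, mem_univ _⟩).hasFDerivWithinAt

theorem hasFDerivAt_slice (hE : IsAdmissibleEnergy T E) {t : ℝ} (ht : t ∈ Icc 0 T) (x : Vec d) :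
    HasFDerivAt (E t)
      ((fderivWithin ℝ (fun q : ℝ × Vec d => E q.1 q.2) (Icc 0 T ×ˢ univ) (t, x)).comp
        (ContinuousLinearMap.inr ℝ ℝ (Vec d))) x := by
  have h := (hE.hasFDerivWithinAt ht x).comp x (s := univ) (f := fun y : Vec d => (t, y))
    (f' := ContinuousLinearMap.inr ℝ ℝ (Vec d))
    ((hasFDerivAt_prodMk_right t x).hasFDerivWithinAt) (fun y _ => ⟨ht, mem_univ _⟩)
  exact hasFDerivWithinAt_univ.1 h

theorem gradient_eq (hE : IsAdmissibleEnergy T E) {t : ℝ} (ht : t ∈ Icc 0 T) (x : Vec d) :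
    gradient (E t) x = (InnerProductSpace.toDual ℝ (Vec d)).symm
      ((fderivWithin ℝ (fun q : ℝ × Vec d => E q.1 q.2) (Icc 0 T ×ˢ univ) (t, x)).comp
        (ContinuousLinearMap.inr ℝ ℝ (Vec d))) :=
  (hE.hasFDerivAt_slice ht x).hasGradientAt.gradient

theorem continuousOn_gradient (hT : 0 < T) (hE : IsAdmissibleEnergy T E) :
    ContinuousOn (fun q : ℝ × Vec d => gradient (E q.1) q.2) (Icc 0 T ×ˢ univ) := by
  have h := hE.contDiffOn.continuousOn_fderivWithin (uniqueDiffOn_timeCylinder hT) le_rfl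
  have h2 : ContinuousOn (fun q : ℝ × Vec d => (InnerProductSpace.toDual ℝ (Vec d)).symm
      ((fderivWithin ℝ (fun q : ℝ × Vec d => E q.1 q.2) (Icc 0 T ×ˢ univ) q).comp
        (ContinuousLinearMap.inr ℝ ℝ (Vec d)))) (Icc 0 T ×ˢ univ) :=
    (LinearIsometryEquiv.continuous _).comp_continuousOn (h.clm_comp continuousOn_const)
  exact h2.congr fun q hq => hE.gradient_eq hq.1 q.2

/-- The chain rule holds because the joint derivative at `(1, x')` splits into its values at `(1,
0)` and `(0, x')`. -/
theorem hasDerivWithinAt_comp (hT : 0 < T) (hE : IsAdmissibleEnergy T E) {t : ℝ}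
    (ht : t ∈ Icc 0 T) {x : ℝ → Vec d} {x' : Vec d} (hx : HasDerivWithinAt x x' (Icc 0 T) t) :
    HasDerivWithinAt (fun s => E s (x s))
      (derivWithin (fun s => E s (x t)) (Icc 0 T) t + inner ℝ (gradient (E t) (x t)) x')
      (Icc 0 T) t := by
  set D := fderivWithin ℝ (fun q : ℝ × Vec d => E q.1 q.2) (Icc 0 T ×ˢ univ) (t, x t) with hD
  have hid : HasDerivWithinAt (fun s : ℝ => s) 1 (Icc 0 T) t := hasDerivWithinAt_id _ _
  have h1 := (hE.hasFDerivWithinAt ht (x t)).comp_hasDerivWithinAt t (f := fun s => (s, x s))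
    (hid.prodMk hx) (fun s hs => ⟨hs, mem_univ _⟩)
  have h2 := (hE.hasFDerivWithinAt ht (x t)).comp_hasDerivWithinAt t (f := fun s => (s, x t))
    (hid.prodMk (hasDerivWithinAt_const _ _ _)) (fun s hs => ⟨hs, mem_univ _⟩)
  have h3 : derivWithin (fun s => E s (x t)) (Icc 0 T) t = D (1, 0) :=
    h2.derivWithin (uniqueDiffOn_Icc hT t ht)
  have h4 : inner ℝ (gradient (E t) (x t)) x' = D (0, x') := by
    rw [hE.gradient_eq ht, InnerProductSpace.toDual_symm_apply]
    simp [hD]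
  rw [h3, h4, ← map_add]
  simpa using! h1

theorem continuousOn_energy (hE : IsAdmissibleEnergy T E) :
    ContinuousOn (fun q : ℝ × Vec d => E q.1 q.2) (Icc 0 T ×ˢ univ) :=
  hE.contDiffOn.continuousOn

theorem exists_bound_on_ball (hE : IsAdmissibleEnergy T E) (M : ℝ) :
    ∃ B, 0 ≤ B ∧ ∀ t ∈ Icc 0 T, ∀ x : Vec d, ‖x‖ ≤ M → |E t x| ≤ B := by
  have hK : IsCompact (Icc 0 T ×ˢ Metric.closedBall (0 : Vec d) M) :=
    isCompact_Icc.prod (isCompact_closedBall _ _)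
  obtain ⟨B, hB⟩ := hK.exists_bound_of_continuousOn
    (hE.continuousOn_energy.mono (prod_mono le_rfl (subset_univ _)))
  exact ⟨max B 0, le_max_right _ _, fun t ht x hx =>
    (hB (t, x) ⟨ht, by simpa using hx⟩).trans (le_max_left _ _)⟩

/-- Superlinear coercivity absorbs every linear term into half of the energy. -/
theorem mul_norm_le (hE : IsAdmissibleEnergy T E) {A : ℝ} (hA : 0 ≤ A) :
    ∃ B, 0 ≤ B ∧ ∀ t ∈ Icc 0 T, ∀ x : Vec d, A * ‖x‖ ≤ E t x / 2 + B := by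
  obtain ⟨C₃, C₄, q, h3, h4, hq, hc⟩ := hE.coercive
  obtain ⟨R, hR⟩ := eventually_atTop.1
    ((tendsto_rpow_atTop (sub_pos.2 hq)).eventually_ge_atTop (2 * A / C₃))
  -- Beyond `R` the choice of threshold gives `A|x| ≤ C₃|x|^q / 2 ≤ (E + C₄) / 2`; the maximum with
  -- `1` keeps `x` away from zero there.
  set R' := max R 1
  refine ⟨A * R' + C₄ / 2, by positivity, fun t ht x => ?_⟩
  have hcx := hc t ht x
  have hpow : 0 ≤ ‖x‖ ^ q := by positivity
  rcases le_or_gt ‖x‖ R' with h | h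
  · nlinarith [mul_le_mul_of_nonneg_left h hA, mul_nonneg h3.le hpow]
  · have hx0 : 0 < ‖x‖ := lt_of_lt_of_le (by positivity) h.le
    have h5 := hR ‖x‖ ((le_max_left _ _).trans h.le)
    rw [div_le_iff₀ h3] at h5
    have h6 : ‖x‖ ^ q = ‖x‖ ^ (q - 1) * ‖x‖ := by
      rw [← Real.rpow_add_one hx0.ne']; ring_nf
    have h7 := mul_le_mul_of_nonneg_right h5 hx0.le
    have : 0 ≤ A * R' := by positivity
    nlinarith

end IsAdmissibleEnergy

/-- Linear growth and Gronwall. The time factor `θ` lets the bound cover cut-off equations, before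
existence is known. -/
theorem exists_control_bound (hf : IsAdmissibleDrift f) (T ρ : ℝ) :
    ∃ U, 0 ≤ U ∧ ∀ (u : ℝ → Vec d) (θ : ℝ → ℝ), ‖u 0‖ ≤ ρ →
      (∀ t ∈ Icc 0 T, 0 ≤ θ t ∧ θ t ≤ 1 ∧ HasDerivWithinAt u (θ t • f (u t)) (Icc 0 T) t) →
      ∀ t ∈ Icc 0 T, ‖u t‖ ≤ U ∧ ‖f (u t)‖ ≤ U := by
  obtain ⟨C, hC⟩ := hf.linear_growth
  have hC0 : 0 ≤ C := by have := (norm_nonneg _).trans (hC 0); simpa using this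
  set U := max (gronwallBound (max ρ 0) C C T) 0
  refine ⟨max U (C * (1 + U)), (le_max_right _ _).trans (le_max_left _ _), ?_⟩
  intro u θ h0 h t ht
  have h1 : ‖u t‖ ≤ U := by
    refine (norm_le_gronwallBound_of_norm_deriv_right_le (f := u) (a := 0) (b := T)
      (f' := fun t => θ t • f (u t)) (δ := max ρ 0) (K := C) (ε := C)
      (fun s hs => (h s hs).2.2.continuousWithinAt) ?_ (h0.trans (le_max_left _ _)) ?_ t ht).trans ?_
    · intro s hs
      exact (h s (Ico_subset_Icc_self hs)).2.2.mono_of_mem_nhdsWithin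
        (Icc_mem_nhdsGE_of_mem hs)
    · intro s hs
      obtain ⟨ha, hb, -⟩ := h s (Ico_subset_Icc_self hs)
      rw [norm_smul, Real.norm_of_nonneg ha]
      nlinarith [hC (u s), norm_nonneg (f (u s))]
    · rw [sub_zero]
      exact (gronwallBound_mono (le_max_right _ _) hC0 hC0 ht.2).trans (le_max_left _ _)
  refine ⟨h1.trans (le_max_left _ _), (hC _).trans ((?_ : _ ≤ C * (1 + U)).trans (le_max_right _ _))⟩
  gcongr

/-- The vector field of the fast-slow system. -/
noncomputable def field (E : ℝ → Vec d → ℝ) (f : Vec d → Vec d) (ε t : ℝ) (y : Vec d × Vec d) :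
    Vec d × Vec d :=
  (ε⁻¹ • (-gradient (E t) y.1 + y.2), f y.2)

/-- Along a slowed-down trajectory the tilted energy `E(t,x) - ⟨u,x⟩` dissipates. -/
theorem hasDerivWithinAt_tiltedEnergy (hT : 0 < T) (hE : IsAdmissibleEnergy T E)
    {ε : ℝ} {y : ℝ → Vec d × Vec d} {c t : ℝ} (ht : t ∈ Icc 0 T)
    (hy : HasDerivWithinAt y (c • field E f ε t (y t)) (Icc 0 T) t) :
    HasDerivWithinAt (fun s => E s (y s).1 - inner ℝ (y s).2 (y s).1)
      (derivWithin (fun s => E s (y t).1) (Icc 0 T) t - c * inner ℝ (f (y t).2) (y t).1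
        - c * (ε⁻¹ * ‖gradient (E t) (y t).1 - (y t).2‖ ^ 2)) (Icc 0 T) t := by
  have hx : HasDerivWithinAt (fun s => (y s).1) (c • (ε⁻¹ • (-gradient (E t) (y t).1 + (y t).2)))
    (Icc 0 T) t := hy.fst
  have hu : HasDerivWithinAt (fun s => (y s).2) (c • f (y t).2) (Icc 0 T) t := hy.snd
  -- The terms containing `x'` combine to `⟨∇ₓE - u, x'⟩`, and `x'` is a negative multiple of `∇ₓE -
  -- u`.
  refine ((hE.hasDerivWithinAt_comp hT ht hx).sub (hu.inner ℝ hx)).congr_deriv ?_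
  set g := gradient (E t) (y t).1
  rw [← real_inner_self_eq_norm_sq]
  simp only [inner_smul_right, inner_smul_left, inner_add_right, inner_sub_left, inner_sub_right,
    inner_neg_right, conj_trivial, real_inner_comm g (y t).2]
  ring

/-- The parameter `ε` enters the tilted energy balance only through a nonpositive term, which is
dropped; hence `M` depends on neither `ε` nor `θ`. -/
theorem exists_state_bound (hT : 0 < T) (hE : IsAdmissibleEnergy T E) (hf : IsAdmissibleDrift f)
    (ρ : ℝ) :
    ∃ M, 0 ≤ M ∧ ∀ (ε : ℝ) (y : ℝ → Vec d × Vec d) (θ : ℝ → ℝ), 0 < ε → ‖y 0‖ ≤ ρ →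
      (∀ t ∈ Icc 0 T, 0 ≤ θ t ∧ θ t ≤ 1 ∧
        HasDerivWithinAt y (θ t • field E f ε t (y t)) (Icc 0 T) t) →
      ∀ t ∈ Icc 0 T, ‖y t‖ ≤ M ∧ ‖f (y t).2‖ ≤ M := by
  obtain ⟨U, hU0, hU⟩ := exists_control_bound hf T ρ
  -- One `B` serves for the norm itself and for the tilt, whose slope is at most `U`.
  obtain ⟨B, hB0, hB⟩ := hE.mul_norm_le (A := max 1 U) (by positivity)
  obtain ⟨D, hD0, hD⟩ := hE.exists_bound_on_ball ρ
  obtain ⟨C₁, C₂, h1, h2, hp⟩ := hE.power_control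
  set G₀ := D + U * max ρ 0
  -- The tilted energy `G` satisfies `G' ≤ C₁ + C₂E + (E/2 + B)`; inserting `E ≤ 2(G + B)` gives `G'
  -- ≤ K G + e`.
  set K := 2 * C₂ + 1
  set e := C₁ + B + K * B
  set G₁ := gronwallBound G₀ K e T
  refine ⟨max U (G₁ + 2 * B), hU0.trans (le_max_left _ _), fun ε y θ hε h0 hy => ?_⟩
  have hu := hU (fun s => (y s).2) θ ((norm_snd_le _).trans h0)
    fun t ht => ⟨(hy t ht).1, (hy t ht).2.1, (hy t ht).2.2.snd⟩
  have hAx : ∀ t ∈ Icc 0 T, ∀ x : Vec d, ‖x‖ ≤ E t x / 2 + B ∧ U * ‖x‖ ≤ E t x / 2 + B :=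
    fun t ht x => ⟨le_trans (by nlinarith [norm_nonneg x, le_max_left 1 U]) (hB t ht x),
      le_trans (by gcongr; exact le_max_right _ _) (hB t ht x)⟩
  have hder := fun t ht => hasDerivWithinAt_tiltedEnergy hT hE ht (hy t ht).2.2
  have hlow : ∀ t ∈ Icc 0 T, E t (y t).1 / 2 - B ≤ E t (y t).1 - inner ℝ (y t).2 (y t).1 := by
    intro t ht
    have := real_inner_le_norm (y t).2 (y t).1
    have h3 := mul_le_mul_of_nonneg_right (hu t ht).1 (norm_nonneg (y t).1)
    linarith [(hAx t ht (y t).1).2]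
  have h00 : (0 : ℝ) ∈ Icc 0 T := ⟨le_rfl, hT.le⟩
  have key : ∀ t ∈ Icc 0 T, E t (y t).1 - inner ℝ (y t).2 (y t).1 ≤ G₁ := by
    intro t ht
    refine (le_gronwallBound_of_liminf_deriv_right_le (a := 0) (b := T) (δ := G₀) (K := K) (ε := e)
      (f' := fun s => derivWithin (fun r => E r (y s).1) (Icc 0 T) s
        - θ s * inner ℝ (f (y s).2) (y s).1
        - θ s * (ε⁻¹ * ‖gradient (E s) (y s).1 - (y s).2‖ ^ 2))
      (fun s hs => (hder s hs).continuousWithinAt) (fun s hs r hr => ?_) ?_ ?_ t ht).trans ?_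
    · exact ((hder s (Ico_subset_Icc_self hs)).mono_of_mem_nhdsWithin
        (Icc_mem_nhdsGE_of_mem hs)).liminf_right_slope_le hr
    · have h5 : ‖(y 0).1‖ ≤ ρ := (norm_fst_le _).trans h0
      have h6 := (abs_le.1 (hD 0 h00 _ h5)).2
      have h7 := neg_le_of_abs_le (abs_real_inner_le_norm (y 0).2 (y 0).1)
      have h8 : ‖(y 0).2‖ * ‖(y 0).1‖ ≤ U * max ρ 0 :=
        mul_le_mul (hu 0 h00).1 (h5.trans (le_max_left _ _)) (norm_nonneg _) hU0
      simp only [G₀]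
      linarith
    · intro s hs
      have hs' := Ico_subset_Icc_self hs
      obtain ⟨ha, hb, -⟩ := hy s hs'
      have h5 := (abs_le.1 (hp s hs' (y s).1)).2
      have h6 := hlow s hs'
      have h7 : -(θ s * inner ℝ (f (y s).2) (y s).1) ≤ U * ‖(y s).1‖ := by
        have h8 := neg_le_of_abs_le (abs_real_inner_le_norm (f (y s).2) (y s).1)
        have h9 : ‖f (y s).2‖ * ‖(y s).1‖ ≤ U * ‖(y s).1‖ :=
          mul_le_mul_of_nonneg_right (hu s hs').2 (norm_nonneg _)
        have h10 : 0 ≤ ‖f (y s).2‖ * ‖(y s).1‖ := by positivity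
        nlinarith
      have h8 : 0 ≤ θ s * (ε⁻¹ * ‖gradient (E s) (y s).1 - (y s).2‖ ^ 2) := by positivity
      have h9 := (hAx s hs' (y s).1).2
      have hK : 0 < K := by positivity
      have h10 := mul_le_mul_of_nonneg_left h6 hK.le
      simp only [e, K] at h10 ⊢
      linarith
    · rw [sub_zero]
      exact gronwallBound_mono (by positivity) (by positivity) (by positivity) ht.2
  intro t ht
  refine ⟨?_, (hu t ht).2.trans (le_max_left _ _)⟩
  rw [Prod.norm_def]
  refine max_le ?_ ((hu t ht).1.trans (le_max_left _ _))
  linarith [(hAx t ht (y t).1).1, hlow t ht, key t ht, le_max_right U (G₁ + 2 * B)]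

namespace IsTrajectory

variable {ε : ℝ} {z : Vec d × Vec d} {y : ℝ → Vec d × Vec d}

theorem hasDerivWithinAt_field (h : IsTrajectory T E f ε z y) {t : ℝ} (ht : t ∈ Icc 0 T) :
    HasDerivWithinAt y (field E f ε t (y t)) (Icc 0 T) t :=
  h.hasDeriv t ht

theorem continuousOn (h : IsTrajectory T E f ε z y) : ContinuousOn y (Icc 0 T) :=
  fun t ht => (h.hasDeriv t ht).continuousWithinAt

theorem continuousOn_gradient_sub (hT : 0 < T) (hE : IsAdmissibleEnergy T E)
    (h : IsTrajectory T E f ε z y) :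
    ContinuousOn (fun t => gradient (E t) (y t).1 - (y t).2) (Icc 0 T) :=
  ((hE.continuousOn_gradient hT).comp (f := fun t => (t, (y t).1))
    (continuousOn_id.prodMk h.continuousOn.fst) fun _ ht => ⟨ht, mem_univ _⟩).sub
    h.continuousOn.snd

end IsTrajectory

theorem exists_trajectory_bound (hT : 0 < T) (hE : IsAdmissibleEnergy T E)
    (hf : IsAdmissibleDrift f) (ρ : ℝ) :
    ∃ M, 0 ≤ M ∧ ∀ (ε : ℝ) (z : Vec d × Vec d) (y : ℝ → Vec d × Vec d), 0 < ε → ‖z‖ ≤ ρ →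
      IsTrajectory T E f ε z y → ∀ t ∈ Icc 0 T, ‖y t‖ ≤ M ∧ ‖f (y t).2‖ ≤ M := by
  obtain ⟨M, hM0, hM⟩ := exists_state_bound hT hE hf ρ
  refine ⟨M, hM0, fun ε z y hε hz h => hM ε y (fun _ => 1) hε (by rwa [h.initial]) fun t ht => ?_⟩
  simpa using h.hasDerivWithinAt_field ht

/-- Integrating the tilted energy balance over `[0,T]`: both endpoint values and the remaining
source terms are bounded uniformly in `ε`. -/
theorem exists_dissipation_bound (hT : 0 < T) (hE : IsAdmissibleEnergy T E)
    (hf : IsAdmissibleDrift f) (ρ : ℝ) :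
    ∃ C, 0 ≤ C ∧ ∀ (ε : ℝ) (z : Vec d × Vec d) (y : ℝ → Vec d × Vec d), 0 < ε → ‖z‖ ≤ ρ →
      IsTrajectory T E f ε z y →
      ∫ t in (0 : ℝ)..T, ‖gradient (E t) (y t).1 - (y t).2‖ ^ 2 ≤ C * ε := by
  obtain ⟨M, hM0, hM⟩ := exists_trajectory_bound hT hE hf ρ
  obtain ⟨D, hD0, hD⟩ := hE.exists_bound_on_ball M
  obtain ⟨C₁, C₂, h1, h2, hp⟩ := hE.power_control
  set A := C₁ + C₂ * D + M * M
  refine ⟨2 * (D + M * M) + A * T, by positivity, fun ε z y hε hz h => ?_⟩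
  have hMy := hM ε z y hε hz h
  have hw : ContinuousOn (fun t => ‖gradient (E t) (y t).1 - (y t).2‖ ^ 2) (Icc 0 T) :=
    (h.continuousOn_gradient_sub hT hE).norm.pow 2
  have hx : ∀ t ∈ Icc 0 T, ‖(y t).1‖ ≤ M := fun t ht => (norm_fst_le _).trans (hMy t ht).1
  have hu : ∀ t ∈ Icc 0 T, ‖(y t).2‖ ≤ M := fun t ht => (norm_snd_le _).trans (hMy t ht).1
  have hG : ∀ t ∈ Icc 0 T, |E t (y t).1 - inner ℝ (y t).2 (y t).1| ≤ D + M * M := by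
    intro t ht
    have h3 := hD t ht _ (hx t ht)
    have h4 := abs_real_inner_le_norm (y t).2 (y t).1
    have h5 : ‖(y t).2‖ * ‖(y t).1‖ ≤ M * M :=
      mul_le_mul (hu t ht) (hx t ht) (norm_nonneg _) hM0
    exact (abs_sub _ _).trans (by linarith)
  have hder := fun (t : ℝ) (ht : t ∈ Icc 0 T) => hasDerivWithinAt_tiltedEnergy (c := 1) hT hE ht
    (by simpa using h.hasDerivWithinAt_field ht)
  have hwi : IntervalIntegrable (fun t => ε⁻¹ * ‖gradient (E t) (y t).1 - (y t).2‖ ^ 2) volume 0 T :=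
    (continuousOn_const.mul hw).intervalIntegrable_of_Icc hT.le
  have hint := intervalIntegral.sub_le_integral_of_hasDeriv_right_of_le (a := 0) (b := T) hT.le
    (fun t ht => (hder t ht).continuousWithinAt)
    (φ := fun t => A - ε⁻¹ * ‖gradient (E t) (y t).1 - (y t).2‖ ^ 2)
    (fun t ht => (hder t (Ioo_subset_Icc_self ht)).mono_of_mem_nhdsWithin
      (Icc_mem_nhdsGT_of_mem (Ioo_subset_Ico_self ht)))
    (by
      rw [← intervalIntegrable_iff_integrableOn_Icc_of_le hT.le]
      exact intervalIntegrable_const.sub hwi)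
    (fun t ht => by
      have ht' := Ioo_subset_Icc_self ht
      have h3 := (abs_le.1 (hp t ht' (y t).1)).2
      have h4 := mul_le_mul_of_nonneg_left (abs_le.1 (hD t ht' _ (hx t ht'))).2 h2.le
      have h5 := neg_le_of_abs_le (abs_real_inner_le_norm (f (y t).2) (y t).1)
      have h6 : ‖f (y t).2‖ * ‖(y t).1‖ ≤ M * M :=
        mul_le_mul (hMy t ht').2 (hx t ht') (norm_nonneg _) hM0
      simp only [A]
      linarith)
  rw [intervalIntegral.integral_sub intervalIntegrable_const hwi,
    intervalIntegral.integral_const_mul, intervalIntegral.integral_const, smul_eq_mul] at hint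
  have h0 := (abs_le.1 (hG 0 ⟨le_rfl, hT.le⟩)).2
  have h3 := (abs_le.1 (hG T ⟨hT.le, le_rfl⟩)).1
  rw [← div_le_iff₀ hε, div_eq_inv_mul]
  linarith

end CriticalEvolution

/-! ### Global existence by cutoff, and continuity of the flow in the data. -/

namespace CriticalEvolution

section Cutoff

variable {F : Type*} [NormedAddCommGroup F]

/-- A Lipschitz cutoff equal to `1` on the ball of radius `R` and to `0` outside the ball of
radius `R + 1`. -/
noncomputable def ballCutoff (R : ℝ) (x : F) : ℝ := max 0 (min 1 (R + 1 - ‖x‖))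

theorem ballCutoff_nonneg (R : ℝ) (x : F) : 0 ≤ ballCutoff R x := le_max_left _ _

theorem ballCutoff_le_one (R : ℝ) (x : F) : ballCutoff R x ≤ 1 :=
  max_le zero_le_one (min_le_left _ _)

theorem ballCutoff_eq_one {R : ℝ} {x : F} (h : ‖x‖ ≤ R) : ballCutoff R x = 1 := by
  rw [ballCutoff, min_eq_left (by linarith), max_eq_right zero_le_one]

theorem ballCutoff_eq_zero {R : ℝ} {x : F} (h : R + 1 ≤ ‖x‖) : ballCutoff R x = 0 := by
  rw [ballCutoff, max_eq_left]
  exact (min_le_right _ _).trans (by linarith)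

theorem abs_ballCutoff_sub_le (R : ℝ) (x y : F) :
    |ballCutoff R x - ballCutoff R y| ≤ ‖x - y‖ := by
  have h : |(R + 1 - ‖x‖) - (R + 1 - ‖y‖)| ≤ ‖x - y‖ := by
    rw [show (R + 1 - ‖x‖) - (R + 1 - ‖y‖) = -(‖x‖ - ‖y‖) by ring, abs_neg]
    exact abs_norm_sub_norm_le x y
  refine le_trans ?_ h
  simp only [ballCutoff]
  refine (abs_max_sub_max_le_max _ _ _ _).trans (max_le (by simp) ?_)
  refine (abs_min_sub_min_le_max _ _ _ _).trans (max_le (by simp) le_rfl)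

variable [NormedSpace ℝ F]

/-- Cutting off a field that is Lipschitz on balls makes it globally Lipschitz. -/
theorem lipschitzWith_ballCutoff_smul {R : ℝ} {g : F → F} {K B : ℝ≥0}
    (hg : LipschitzOnWith K g (Metric.closedBall 0 (R + 1)))
    (hB : ∀ x ∈ Metric.closedBall (0 : F) (R + 1), ‖g x‖ ≤ B) :
    LipschitzWith (B + K) fun x => ballCutoff R x • g x := by
  -- Only `x` need lie in the ball: if `y` lies outside, its cutoff factor vanishes, so no Lipschitz
  -- bound for `g` is needed there.
  have key : ∀ x y : F, x ∈ Metric.closedBall (0 : F) (R + 1) →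
      ‖ballCutoff R x • g x - ballCutoff R y • g y‖ ≤ (B + K) * ‖x - y‖ := by
    intro x y hx
    have h1 : ‖(ballCutoff R x - ballCutoff R y) • g x‖ ≤ B * ‖x - y‖ := by
      rw [norm_smul, mul_comm]
      exact mul_le_mul (hB x hx) (abs_ballCutoff_sub_le R x y) (norm_nonneg _) B.2
    have h2 : ‖ballCutoff R y • (g x - g y)‖ ≤ K * ‖x - y‖ := by
      by_cases hy : y ∈ Metric.closedBall (0 : F) (R + 1)
      · rw [norm_smul, Real.norm_of_nonneg (ballCutoff_nonneg R y)]
        have h3 := hg.norm_sub_le hx hy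
        nlinarith [ballCutoff_nonneg R y, ballCutoff_le_one R y, norm_nonneg (g x - g y)]
      · rw [mem_closedBall_zero_iff, not_le] at hy
        rw [ballCutoff_eq_zero hy.le, zero_smul, norm_zero]
        positivity
    have h3 : ballCutoff R x • g x - ballCutoff R y • g y =
        (ballCutoff R x - ballCutoff R y) • g x + ballCutoff R y • (g x - g y) := by
      rw [sub_smul, smul_sub]; abel
    rw [h3, add_mul]
    exact (norm_add_le _ _).trans (add_le_add h1 h2)
  refine LipschitzWith.of_dist_le_mul fun x y => ?_
  rw [dist_eq_norm, dist_eq_norm, NNReal.coe_add]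
  by_cases hx : x ∈ Metric.closedBall (0 : F) (R + 1)
  · exact key x y hx
  by_cases hy : y ∈ Metric.closedBall (0 : F) (R + 1)
  · rw [norm_sub_rev, norm_sub_rev x]
    exact key y x hy
  · rw [mem_closedBall_zero_iff, not_le] at hx hy
    rw [ballCutoff_eq_zero hx.le, ballCutoff_eq_zero hy.le]
    simp only [zero_smul, sub_zero, norm_zero]
    positivity

/-- Global existence for an ODE cut off outside a ball. -/
theorem exists_solution_ballCutoff [CompleteSpace F] {T : ℝ} (hT : 0 ≤ T) {v : ℝ → F → F}
    (hcont : ∀ x, ContinuousOn (v · x) (Icc 0 T))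
    (hlip : ∀ R : ℝ, ∃ K : ℝ≥0, ∀ t ∈ Icc 0 T, LipschitzOnWith K (v t) (Metric.closedBall 0 R))
    {R : ℝ} (hR : 0 ≤ R) (z : F) :
    ∃ y : ℝ → F, y 0 = z ∧
      ∀ t ∈ Icc 0 T, HasDerivWithinAt y (ballCutoff R (y t) • v t (y t)) (Icc 0 T) t := by
  obtain ⟨K, hK⟩ := hlip (R + 1)
  obtain ⟨B₀, hB₀⟩ := isCompact_Icc.exists_bound_of_continuousOn (hcont 0)
  have h00 : (0 : ℝ) ∈ Icc 0 T := ⟨le_rfl, hT⟩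
  have hB₀0 : 0 ≤ B₀ := (norm_nonneg _).trans (hB₀ 0 h00)
  set B : ℝ≥0 := ⟨B₀ + K * (R + 1), by positivity⟩
  have hB : ∀ t ∈ Icc 0 T, ∀ x ∈ Metric.closedBall (0 : F) (R + 1), ‖v t x‖ ≤ B := by
    intro t ht x hx
    have h1 := (hK t ht).norm_sub_le hx (Metric.mem_closedBall_self (by linarith))
    rw [sub_zero] at h1
    have h2 : (K : ℝ) * ‖x‖ ≤ K * (R + 1) := by
      gcongr; simpa using hx
    have h3 := norm_sub_norm_le (v t x) (v t 0)
    have h4 := hB₀ t ht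
    show _ ≤ B₀ + K * (R + 1)
    linarith
  -- The cut-off field is bounded by `B` everywhere, so radius `B * T` carries the solution over the
  -- whole interval.
  have hPL : IsPicardLindelof (fun t x => ballCutoff R x • v t x) (tmin := 0) (tmax := T)
      ⟨0, h00⟩ z (B * ⟨T, hT⟩) 0 B (B + K) := by
    refine ⟨fun t ht => (lipschitzWith_ballCutoff_smul (hK t ht) (hB t ht)).lipschitzOnWith,
      fun x _ => (hcont x).const_smul _, fun t ht x _ => ?_, ?_⟩
    · by_cases hx : x ∈ Metric.closedBall (0 : F) (R + 1)
      · rw [norm_smul, Real.norm_of_nonneg (ballCutoff_nonneg R x)]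
        nlinarith [ballCutoff_le_one R x, ballCutoff_nonneg R x, hB t ht x hx,
          norm_nonneg (v t x)]
      · rw [mem_closedBall_zero_iff, not_le] at hx
        rw [ballCutoff_eq_zero hx.le, zero_smul, norm_zero]
        exact B.2
    · have h : (B : ℝ) * max (T - 0) (0 - 0) ≤ B * T - 0 := by simp [hT]
      exact h
  exact hPL.exists_eq_forall_mem_Icc_hasDerivWithinAt₀

end Cutoff

variable {d : ℕ} {T : ℝ} {E : ℝ → Vec d → ℝ} {f : Vec d → Vec d}

theorem continuousOn_field_time (hT : 0 < T) (hE : IsAdmissibleEnergy T E) (ε : ℝ)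
    (y : Vec d × Vec d) : ContinuousOn (fun t => field E f ε t y) (Icc 0 T) := by
  have h : ContinuousOn (fun t => gradient (E t) y.1) (Icc 0 T) :=
    (hE.continuousOn_gradient hT).comp (f := fun t => (t, y.1))
      (continuousOn_id.prodMk continuousOn_const) fun _ ht => ⟨ht, mem_univ _⟩
  unfold field
  exact ((h.neg.add continuousOn_const).const_smul ε⁻¹).prodMk continuousOn_const

theorem IsAdmissibleDrift.exists_lipschitzOnWith (hf : IsAdmissibleDrift f) (R : ℝ) :
    ∃ L : ℝ≥0, LipschitzOnWith L f (Metric.closedBall 0 R) :=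
  (hf.locallyLipschitz.locallyLipschitzOn).exists_lipschitzOnWith_of_compact
    (isCompact_closedBall _ _)

theorem exists_lipschitzOnWith_field (hE : IsAdmissibleEnergy T E) (hf : IsAdmissibleDrift f)
    (ε R : ℝ) :
    ∃ K : ℝ≥0, ∀ t ∈ Icc 0 T, LipschitzOnWith K (field E f ε t) (Metric.closedBall 0 R) := by
  obtain ⟨L, hL⟩ := hE.lipschitz_gradient R
  obtain ⟨L', hL'⟩ := hf.exists_lipschitzOnWith R
  have hball : ∀ y ∈ Metric.closedBall (0 : Vec d × Vec d) R,
      y.1 ∈ Metric.closedBall (0 : Vec d) R ∧ y.2 ∈ Metric.closedBall (0 : Vec d) R := by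
    intro y hy
    rw [mem_closedBall_zero_iff] at hy
    exact ⟨by simpa using (norm_fst_le y).trans hy, by simpa using (norm_snd_le y).trans hy⟩
  refine ⟨max (‖ε⁻¹‖₊ * (L + 1)) L', fun t ht => LipschitzOnWith.of_dist_le_mul fun x hx y hy => ?_⟩
  have h1 : dist x.1 y.1 ≤ dist x y := le_max_left _ _
  have h2 : dist x.2 y.2 ≤ dist x y := le_max_right _ _
  have h3 := (hL t ht).dist_le_mul _ (hball x hx).1 _ (hball y hy).1
  have h4 := hL'.dist_le_mul _ (hball x hx).2 _ (hball y hy).2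
  rw [NNReal.coe_max, max_mul_of_nonneg _ _ dist_nonneg, Prod.dist_eq]
  refine max_le_max ?_ (h4.trans (by gcongr))
  simp only [field]
  rw [dist_smul₀, NNReal.coe_mul, mul_assoc]
  refine mul_le_mul le_rfl ?_ dist_nonneg (norm_nonneg _)
  refine (dist_add_add_le _ _ _ _).trans ?_
  rw [dist_neg_neg, NNReal.coe_add, NNReal.coe_one, add_mul, one_mul]
  exact add_le_add (h3.trans (by gcongr)) h2

/-- The bound for slowed-down trajectories does not depend on the cutoff, so the cutoff radius can
be that bound itself. The cut-off solution then stays where the cutoff equals one. -/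
theorem exists_isTrajectory (hT : 0 < T) (hE : IsAdmissibleEnergy T E) (hf : IsAdmissibleDrift f)
    {ε : ℝ} (hε : 0 < ε) (z : Vec d × Vec d) :
    ∃ y : ℝ → Vec d × Vec d, IsTrajectory T E f ε z y := by
  obtain ⟨M, hM0, hM⟩ := exists_state_bound hT hE hf ‖z‖
  obtain ⟨y, hy0, hy⟩ := exists_solution_ballCutoff hT.le (continuousOn_field_time (f := f) hT hE ε)
    (exists_lipschitzOnWith_field hE hf ε) hM0 z
  have hb := hM ε y (fun t => ballCutoff M (y t)) hε (by rw [hy0])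
    fun t ht => ⟨ballCutoff_nonneg _ _, ballCutoff_le_one _ _, hy t ht⟩
  refine ⟨y, hy0, fun t ht => ?_⟩
  have h := hy t ht
  rwa [ballCutoff_eq_one (hb t ht).1, one_smul] at h

theorem isTrajectory_flow (hT : 0 < T) (hE : IsAdmissibleEnergy T E) (hf : IsAdmissibleDrift f)
    {ε : ℝ} (hε : 0 < ε) (z : Vec d × Vec d) : IsTrajectory T E f ε z (flow T E f ε z) := by
  have h := exists_isTrajectory hT hE hf hε z
  rw [flow, dif_pos h]
  exact h.choose_spec

/-- Gronwall on the ball confining both trajectories. The constant may blow up as `ε → 0`; it serves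
only continuity at fixed `ε`. -/
theorem exists_dist_flow_le (hT : 0 < T) (hE : IsAdmissibleEnergy T E) (hf : IsAdmissibleDrift f)
    {ε : ℝ} (hε : 0 < ε) (ρ : ℝ) :
    ∃ L : ℝ, 0 ≤ L ∧ ∀ z z' : Vec d × Vec d, ‖z‖ ≤ ρ → ‖z'‖ ≤ ρ → ∀ t ∈ Icc 0 T,
      dist (flow T E f ε z t) (flow T E f ε z' t) ≤ L * dist z z' := by
  obtain ⟨M, hM0, hM⟩ := exists_trajectory_bound hT hE hf ρ
  obtain ⟨K, hK⟩ := exists_lipschitzOnWith_field hE hf ε M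
  refine ⟨Real.exp (K * T), (Real.exp_pos _).le, fun z z' hz hz' t ht => ?_⟩
  have h := isTrajectory_flow hT hE hf hε z
  have h' := isTrajectory_flow hT hE hf hε z'
  have hder : ∀ {w : Vec d × Vec d}, IsTrajectory T E f ε w (flow T E f ε w) → ∀ t ∈ Ico 0 T,
      HasDerivWithinAt (flow T E f ε w) (field E f ε t (flow T E f ε w t)) (Ici t) t :=
    fun hw t ht => (hw.hasDerivWithinAt_field (Ico_subset_Icc_self ht)).mono_of_mem_nhdsWithin
      (Icc_mem_nhdsGE_of_mem ht)
  have hmem : ∀ {w : Vec d × Vec d}, ‖w‖ ≤ ρ → IsTrajectory T E f ε w (flow T E f ε w) →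
      ∀ t ∈ Ico 0 T, flow T E f ε w t ∈ Metric.closedBall (0 : Vec d × Vec d) M :=
    fun hw hw' t ht => by simpa using (hM ε _ _ hε hw hw' t (Ico_subset_Icc_self ht)).1
  have := dist_le_of_trajectories_ODE_of_mem (v := field E f ε)
    (s := fun _ => Metric.closedBall (0 : Vec d × Vec d) M) (K := K) (δ := dist z z')
    (fun t ht => hK t (Ico_subset_Icc_self ht))
    h.continuousOn (hder h) (hmem hz h) h'.continuousOn (hder h') (hmem hz' h')
    (by rw [h.initial, h'.initial]) t ht
  refine this.trans ?_
  rw [mul_comm, sub_zero]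
  gcongr
  exact ht.2

theorem continuous_flowCurves (hT : 0 < T) (hE : IsAdmissibleEnergy T E)
    (hf : IsAdmissibleDrift f) {ε : ℝ} (hε : 0 < ε) :
    Continuous (stateCurve T E f ε) ∧ Continuous (controlCurve T E f ε) := by
  constructor <;> refine continuous_iff_continuousAt.2 fun z => ?_ <;>
  · obtain ⟨L, hL0, hL⟩ := exists_dist_flow_le hT hE hf hε (‖z‖ + 1)
    refine continuousAt_of_locally_lipschitz one_pos L fun w hw => ?_
    have hw' : ‖w‖ ≤ ‖z‖ + 1 := by
      rw [dist_eq_norm] at hw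
      have := norm_sub_norm_le w z
      linarith
    refine (ContinuousMap.dist_le (by positivity)).2 fun t => le_trans ?_
      (hL w z hw' (by linarith) t t.2)
    first | exact le_max_left _ _ | exact le_max_right _ _

theorem continuous_liftMap (hT : 0 < T) (hE : IsAdmissibleEnergy T E) (hf : IsAdmissibleDrift f)
    (p : ℝ≥0∞) [Fact (1 ≤ p)] {ε : ℝ} (hε : 0 < ε) : Continuous (liftMap T p E f ε) := by
  obtain ⟨h1, h2⟩ := continuous_flowCurves hT hE hf hε
  exact continuous_fst.prodMk (continuous_snd.prodMk
    (((ContinuousMap.toLp (E := Vec d) p (timeMeasure T) ℝ).continuous.comp h1).prodMk h2))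

end CriticalEvolution

/-! ### Cost of leaving an isolated critical point. -/

namespace CriticalEvolution

/-- A bounded monotone function on `ℚ` has small oscillation around all but countably many reals. -/
theorem countable_rat_jumps {V : ℚ → ℝ} (hV : Monotone V) {B : ℝ} (hB : ∀ q, V q ≤ B) :
    {t : ℝ | ¬ ∀ η > 0, ∃ q q' : ℚ, (q : ℝ) < t ∧ t < q' ∧ V q' - V q < η}.Countable := by
  -- A monotone extension to the reals, whose continuity points carry no jump of `V`.
  set W : ℝ → ℝ := fun t => sSup (V '' {q : ℚ | (q : ℝ) ≤ t})
  have hbdd : ∀ t : ℝ, BddAbove (V '' {q : ℚ | (q : ℝ) ≤ t}) :=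
    fun t => ⟨B, by rintro _ ⟨q, -, rfl⟩; exact hB q⟩
  have hne : ∀ t : ℝ, (V '' {q : ℚ | (q : ℝ) ≤ t}).Nonempty := fun t => by
    obtain ⟨q, hq⟩ := exists_rat_lt t
    exact ⟨V q, q, hq.le, rfl⟩
  have hW : Monotone W := fun s t hst =>
    csSup_le_csSup (hbdd t) (hne s) (image_mono fun q (hq : (q : ℝ) ≤ s) => hq.trans hst)
  refine hW.countable_not_continuousAt.mono fun t ht => ?_
  simp only [mem_ofPred_eq] at ht ⊢
  refine fun hc => ht fun η hη => ?_
  obtain ⟨δ, hδ, h⟩ := Metric.continuousAt_iff.1 hc (η / 2) (half_pos hη)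
  obtain ⟨q, hq1, hq2⟩ := exists_rat_btwn (show t - δ / 2 < t by linarith)
  obtain ⟨q', hq1', hq2'⟩ := exists_rat_btwn (show t < t + δ / 2 by linarith)
  have h1 : W (t - δ / 2) ≤ V q := csSup_le (hne _) (by
    rintro _ ⟨r, hr, rfl⟩
    exact hV (by exact_mod_cast (le_trans hr hq1.le)))
  have h2 : V q' ≤ W (t + δ / 2) := le_csSup (hbdd _) ⟨q', hq2'.le, rfl⟩
  have h3 := (abs_lt.1 (h (x := t - δ / 2) (by
    rw [Real.dist_eq, abs_lt]; constructor <;> linarith))).1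
  have h4 := (abs_lt.1 (h (x := t + δ / 2) (by
    rw [Real.dist_eq, abs_lt]; constructor <;> linarith))).2
  exact ⟨q, q', hq2, hq1', by linarith⟩

/-- Crossing an annulus on which the driving force is at least `m` dissipates at least `m` times
its width. -/
theorem mul_le_integral_of_crossing {F : Type*} [NormedAddCommGroup F] [NormedSpace ℝ F]
    [CompleteSpace F] {x w : ℝ → F} {e a b : ℝ} (he : 0 ≤ e) (hab : a ≤ b)
    (hw : ContinuousOn w (Icc a b))
    (hx : ∀ s ∈ Icc a b, HasDerivWithinAt x (e • w s) (Icc a b) s) {c : F} {r₁ r₂ m : ℝ}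
    (hm : 0 ≤ m)
    (hmw : ∀ s ∈ Icc a b, r₁ ≤ ‖x s - c‖ → ‖x s - c‖ ≤ r₂ → m ≤ ‖w s‖)
    (hb : ‖x b - c‖ ≤ r₁) (ha : r₂ ≤ ‖x a - c‖) :
    m * (r₂ - r₁) ≤ e * ∫ s in a..b, ‖w s‖ ^ 2 := by
  have hxc : ContinuousOn x (Icc a b) := fun s hs => (hx s hs).continuousWithinAt
  have hN : ContinuousOn (fun s => ‖x s - c‖) (Icc a b) := (hxc.sub continuousOn_const).norm
  -- Take the last time `s₁` at distance at least `r₂`, then the first later time `s₂` at distance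
  -- at most `r₁`; strictly between them the path stays in the annulus.
  obtain ⟨s₁, ⟨hs₁, hs₁'⟩, hmax⟩ := (isCompact_Icc.of_isClosed_subset
    (hN.preimage_isClosed_of_isClosed isClosed_Icc (isClosed_Ici (a := r₂)))
    inter_subset_left).exists_isGreatest ⟨a, ⟨le_rfl, hab⟩, ha⟩
  have hN2 : ContinuousOn (fun s => ‖x s - c‖) (Icc s₁ b) := hN.mono (Icc_subset_Icc_left hs₁.1)
  obtain ⟨s₂, ⟨hs₂, hs₂'⟩, hmin⟩ := (isCompact_Icc.of_isClosed_subset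
    (hN2.preimage_isClosed_of_isClosed isClosed_Icc (isClosed_Iic (a := r₁)))
    inter_subset_left).exists_isLeast ⟨b, ⟨hs₁.2, le_rfl⟩, hb⟩
  have hsub : Icc s₁ s₂ ⊆ Icc a b := Icc_subset_Icc hs₁.1 hs₂.2
  have hann : ∀ s ∈ Ioo s₁ s₂, m ≤ ‖w s‖ := by
    intro s hs
    have hs' := hsub (Ioo_subset_Icc_self hs)
    refine hmw s hs' ?_ ?_
    · by_contra! h
      exact absurd (hmin ⟨⟨hs.1.le, hs'.2⟩, h.le⟩) (not_le.2 hs.2)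
    · by_contra! h
      exact absurd (hmax ⟨hs', h.le⟩) (not_le.2 hs.1)
  have hw1 : ContinuousOn w (Icc s₁ s₂) := hw.mono hsub
  have hi : IntervalIntegrable (fun s => ‖w s‖ ^ 2) volume s₁ s₂ :=
    (hw1.norm.pow 2).intervalIntegrable_of_Icc hs₂.1
  have hFTC := intervalIntegral.integral_eq_sub_of_hasDerivAt_of_le hs₂.1 (hxc.mono hsub)
    (fun s hs => (hx s (hsub (Ioo_subset_Icc_self hs))).hasDerivAt
      (Icc_mem_nhds (hs₁.1.trans_lt hs.1) (hs.2.trans_le hs₂.2)))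
    ((continuousOn_const.smul hw1).intervalIntegrable_of_Icc hs₂.1)
  rw [intervalIntegral.integral_smul] at hFTC
  have h1 : r₂ - r₁ ≤ ‖x s₂ - x s₁‖ := by
    have := norm_sub_norm_le (x s₁ - c) (x s₂ - c)
    rw [sub_sub_sub_cancel_right, norm_sub_rev (x s₁) (x s₂)] at this
    have e1 : r₂ ≤ ‖x s₁ - c‖ := hs₁'
    have e2 : ‖x s₂ - c‖ ≤ r₁ := hs₂'
    linarith
  have h2 : ‖x s₂ - x s₁‖ ≤ e * ∫ s in s₁..s₂, ‖w s‖ := by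
    rw [← hFTC, norm_smul, Real.norm_of_nonneg he]
    gcongr
    exact intervalIntegral.norm_integral_le_integral_norm hs₂.1
  have h3 : m * ∫ s in s₁..s₂, ‖w s‖ ≤ ∫ s in s₁..s₂, ‖w s‖ ^ 2 := by
    rw [← intervalIntegral.integral_const_mul]
    refine intervalIntegral.integral_mono_on_of_le_Ioo hs₂.1
      ((continuousOn_const.mul hw1.norm).intervalIntegrable_of_Icc hs₂.1) hi fun s hs => ?_
    rw [sq]
    exact mul_le_mul_of_nonneg_right (hann s hs) (norm_nonneg _)
  have h4 : ∫ s in s₁..s₂, ‖w s‖ ^ 2 ≤ ∫ s in a..b, ‖w s‖ ^ 2 :=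
    intervalIntegral.integral_mono_interval hs₁.1 hs₂.1 hs₂.2
      (Eventually.of_forall fun s => by positivity)
      ((hw.norm.pow 2).intervalIntegrable_of_Icc hab)
  calc m * (r₂ - r₁) ≤ m * (e * ∫ s in s₁..s₂, ‖w s‖) := by gcongr; exact h1.trans h2
    _ = e * (m * ∫ s in s₁..s₂, ‖w s‖) := by ring
    _ ≤ _ := by gcongr; exact h3.trans h4

variable {d : ℕ} {T : ℝ} {E : ℝ → Vec d → ℝ} {f : Vec d → Vec d}

/-- The energy dissipated by `y` up to time `t`. -/
noncomputable def dissipation (E : ℝ → Vec d → ℝ) (ε : ℝ) (y : ℝ → Vec d × Vec d) (t : ℝ) : ℝ :=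
  ε⁻¹ * ∫ s in (0 : ℝ)..t, ‖gradient (E s) (y s).1 - (y s).2‖ ^ 2

theorem IsTrajectory.dissipation_sub (hT : 0 < T) (hE : IsAdmissibleEnergy T E) {ε : ℝ}
    {z : Vec d × Vec d} {y : ℝ → Vec d × Vec d} (h : IsTrajectory T E f ε z y)
    {s t : ℝ} (hs : s ∈ Icc 0 T) (ht : t ∈ Icc 0 T) :
    dissipation E ε y t - dissipation E ε y s =
      ε⁻¹ * ∫ r in s..t, ‖gradient (E r) (y r).1 - (y r).2‖ ^ 2 := by
  have hi : ∀ a ∈ Icc 0 T, IntervalIntegrable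
      (fun r => ‖gradient (E r) (y r).1 - (y r).2‖ ^ 2) volume 0 a := fun a ha =>
    (((h.continuousOn_gradient_sub hT hE).norm.pow 2).mono
      (Icc_subset_Icc_right ha.2)).intervalIntegrable_of_Icc ha.1
  rw [dissipation, dissipation, ← mul_sub, intervalIntegral.integral_interval_sub_left (hi t ht)
    (hi s hs)]

theorem IsTrajectory.dissipation_mono (hT : 0 < T) (hE : IsAdmissibleEnergy T E) {ε : ℝ}
    (hε : 0 < ε) {z : Vec d × Vec d} {y : ℝ → Vec d × Vec d} (h : IsTrajectory T E f ε z y)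
    {s t : ℝ} (hs : s ∈ Icc 0 T) (ht : t ∈ Icc 0 T) (hst : s ≤ t) :
    dissipation E ε y s ≤ dissipation E ε y t := by
  rw [← sub_nonneg, h.dissipation_sub hT hE hs ht]
  have := intervalIntegral.integral_nonneg (μ := volume)
    (f := fun r => ‖gradient (E r) (y r).1 - (y r).2‖ ^ 2) hst fun r _ => by positivity
  positivity

/-- Near an isolated critical point the driving force stays bounded away from zero on small
annuli, uniformly for nearby times and controls. -/
theorem exists_force_gap (hT : 0 < T) (hE : IsAdmissibleEnergy T E) {u : ℕ → ℝ → Vec d} {M t : ℝ}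
    (ht : t ∈ Icc 0 T) (hu : ∀ n, ∀ s ∈ Icc 0 T, ‖u n s - u n t‖ ≤ M * |s - t|) {v : Vec d}
    (hv : Tendsto (fun n => u n t) atTop (𝓝 v)) {a : Vec d} {r δ : ℝ} (hr : 0 < r) (hrδ : r < δ)
    (hδ : ∀ y, gradient (E t) y = v → dist y a < δ → y = a) :
    ∃ m > 0, ∃ η > 0, ∀ᶠ n in atTop, ∀ s ∈ Icc 0 T, |s - t| ≤ η → ∀ x : Vec d,
      r / 2 ≤ ‖x - a‖ → ‖x - a‖ ≤ r → m ≤ ‖gradient (E s) x - u n s‖ := by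
  set A : Set (Vec d) := Metric.closedBall a r ∩ {x | r / 2 ≤ ‖x - a‖}
  have hA : IsCompact A := (isCompact_closedBall a r).inter_right
    (isClosed_le continuous_const (by fun_prop))
  have hgt : ContinuousOn (fun x => ‖gradient (E t) x - v‖) A :=
    (((hE.continuousOn_gradient hT).comp (f := fun x : Vec d => (t, x))
      (by fun_prop) fun _ _ => ⟨ht, mem_univ _⟩).sub continuousOn_const).norm
  -- The factor `4` leaves `m` after three errors of size `m`: time shift in the gradient, time
  -- shift in the control, and convergence of `u n t` to `v`.
  have hm : ∃ m > 0, ∀ x ∈ A, 4 * m ≤ ‖gradient (E t) x - v‖ := by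
    rcases A.eq_empty_or_nonempty with h | h
    · exact ⟨1, one_pos, by simp [h]⟩
    obtain ⟨x₀, hx₀, hmin⟩ := hA.exists_isMinOn h hgt
    refine ⟨‖gradient (E t) x₀ - v‖ / 4, ?_, fun x hx => ?_⟩
    · refine div_pos (norm_pos_iff.2 fun h0 => ?_) (by norm_num)
      have h1 := hδ x₀ (sub_eq_zero.1 h0) ((Metric.mem_closedBall.1 hx₀.1).trans_lt hrδ)
      have h2 := hx₀.2
      simp only [h1, mem_ofPred_eq, sub_self, norm_zero] at h2
      linarith
    · have := isMinOn_iff.1 hmin x hx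
      linarith
  obtain ⟨m, hm0, hm⟩ := hm
  have hK : IsCompact (Icc 0 T ×ˢ Metric.closedBall a r) :=
    isCompact_Icc.prod (isCompact_closedBall _ _)
  have huc := hK.uniformContinuousOn_of_continuous
    ((hE.continuousOn_gradient hT).mono (prod_mono le_rfl (subset_univ _)))
  obtain ⟨η, hη, hηm⟩ := Metric.uniformContinuousOn_iff.1 huc m hm0
  have hM : 0 < |M| + 1 := by positivity
  refine ⟨m, hm0, min (η / 2) (m / (|M| + 1)), by positivity, ?_⟩
  filter_upwards [Metric.tendsto_nhds.1 hv m hm0] with n hn s hs hst x hx1 hx2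
  have hxb : x ∈ Metric.closedBall a r := by rwa [Metric.mem_closedBall, dist_eq_norm]
  have h1 := hm x ⟨hxb, hx1⟩
  have h2 : ‖gradient (E s) x - gradient (E t) x‖ < m := by
    rw [← dist_eq_norm]
    refine hηm (s, x) ⟨hs, hxb⟩ (t, x) ⟨ht, hxb⟩ ?_
    rw [Prod.dist_eq, dist_self, Real.dist_eq]
    exact max_lt ((hst.trans (min_le_left _ _)).trans_lt (by linarith)) hη
  have h3 : ‖u n s - u n t‖ ≤ m := by
    have h4 := hst.trans (min_le_right _ _)
    rw [le_div_iff₀ hM] at h4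
    have := hu n s hs
    nlinarith [le_abs_self M, abs_nonneg (s - t)]
  rw [dist_eq_norm] at hn
  have h5 : gradient (E t) x - v = (gradient (E s) x - u n s)
      - (gradient (E s) x - gradient (E t) x) + (u n s - u n t) + (u n t - v) := by abel
  have h6 := norm_add_le ((gradient (E s) x - u n s)
      - (gradient (E s) x - gradient (E t) x) + (u n s - u n t)) (u n t - v)
  have h7 := norm_add_le ((gradient (E s) x - u n s)
      - (gradient (E s) x - gradient (E t) x)) (u n s - u n t)
  have h8 := norm_sub_le (gradient (E s) x - u n s) (gradient (E s) x - gradient (E t) x)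
  rw [h5] at h1
  linarith

section Pointwise

variable {εs : ℕ → ℝ} {z : ℕ → Vec d × Vec d} {y : ℕ → ℝ → Vec d × Vec d}

/-- At a time where the limit dissipation does not jump, every cluster point of the states is the
left limit of the limit states at rational times. -/
theorem left_limit_of_mapClusterPt (hT : 0 < T) (hE : IsAdmissibleEnergy T E)
    (hε : ∀ n, 0 < εs n) (hy : ∀ n, IsTrajectory T E f (εs n) (z n) (y n)) {M : ℝ}
    (hM : ∀ n, ∀ t ∈ Icc 0 T, ‖f (y n t).2‖ ≤ M) {X : ℚ → Vec d} {V : ℚ → ℝ} (hVm : Monotone V)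
    (hX : ∀ q : ℚ, Tendsto (fun n => (y n (projIcc 0 T hT.le q)).1) atTop (𝓝 (X q)))
    (hV : ∀ q : ℚ, Tendsto (fun n => dissipation E (εs n) (y n) (projIcc 0 T hT.le q)) atTop
      (𝓝 (V q)))
    {t : ℝ} (ht : t ∈ Ioo 0 T)
    (hjump : ∀ η > 0, ∃ q q' : ℚ, (q : ℝ) < t ∧ t < q' ∧ V q' - V q < η)
    {v : Vec d} (hv : Tendsto (fun n => (y n t).2) atTop (𝓝 v))
    (hw : Tendsto (fun n => gradient (E t) (y n t).1 - (y n t).2) atTop (𝓝 0))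
    {a : Vec d} (ha : MapClusterPt a atTop fun n => (y n t).1) {r : ℝ} (hr : 0 < r) :
    ∃ s < t, ∀ q : ℚ, s < q → (q : ℝ) < t → ‖X q - a‖ ≤ r := by
  have ht' := Ioo_subset_Icc_self ht
  have hcrit : gradient (E t) a = v := by
    obtain ⟨U, hU, hUa⟩ := mapClusterPt_iff_ultrafilter.1 ha
    have hc : Continuous (gradient (E t)) := by
      rw [← continuousOn_univ]
      exact (hE.continuousOn_gradient hT).comp (f := fun x : Vec d => (t, x))
        (by fun_prop) fun _ _ => ⟨ht', mem_univ _⟩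
    have h1 := ((hc.tendsto a).comp hUa).sub (hv.mono_left hU)
    exact sub_eq_zero.1 (tendsto_nhds_unique h1 (hw.mono_left hU))
  obtain ⟨δ, hδ0, hδ⟩ := hE.isolated t ht' v a hcrit
  -- Shrinking `r` strengthens the claim, and below `δ` the annulus contains no critical point.
  wlog hrδ : r < δ generalizing r
  · obtain ⟨s, hs, h⟩ := this (r := min r (δ / 2)) (by positivity)
      ((min_le_right _ _).trans_lt (by linarith))
    exact ⟨s, hs, fun q h1 h2 => (h q h1 h2).trans (min_le_left _ _)⟩
  have hlip : ∀ n, ∀ s ∈ Icc 0 T, ‖(y n s).2 - (y n t).2‖ ≤ M * |s - t| := fun n s hs =>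
    (convex_Icc 0 T).norm_image_sub_le_of_norm_hasDerivWithin_le
      (fun s hs => ((hy n).hasDeriv s hs).snd) (hM n) ht' hs
  obtain ⟨m, hm, η, hη, hgap⟩ := exists_force_gap hT hE (u := fun n s => (y n s).2) ht' hlip hv hr
    hrδ hδ
  -- The tolerance is exactly the cost of crossing from radius `r` to radius `r / 2`.
  obtain ⟨q₀, q', hq₀, hq', hVq⟩ := hjump (m * (r / 2)) (by positivity)
  refine ⟨max (max q₀ (t - η)) 0, max_lt (max_lt hq₀ (by linarith)) ht.1, fun q hq hqt => ?_⟩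
  have hq1 : (q₀ : ℝ) < q := ((le_max_left _ _).trans (le_max_left _ _)).trans_lt hq
  have hq2 : t - η < q := ((le_max_right _ _).trans (le_max_left _ _)).trans_lt hq
  have hq3 : 0 < (q : ℝ) := (le_max_right _ _).trans_lt hq
  have hqI : (q : ℝ) ∈ Icc 0 T := ⟨hq3.le, (hqt.trans ht.2).le⟩
  have hpq : ((projIcc 0 T hT.le q : Icc 0 T) : ℝ) = q := by rw [projIcc_of_mem _ hqI]
  have hVlt : V q' - V q < m * (r / 2) := by
    have := hVm (show q₀ ≤ q by exact_mod_cast hq1.le)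
    linarith
  have hev := ((hV q').sub (hV q)).eventually_lt_const hVlt
  have htq' : t ≤ (projIcc 0 T hT.le (q' : ℝ) : Icc 0 T) := by
    rw [coe_projIcc]
    exact le_max_of_le_right (le_min ht.2.le hq'.le)
  have hfreq := ((ha.frequently (Metric.closedBall_mem_nhds a (half_pos hr))).and_eventually
    (hev.and hgap))
  have hXa := (hX q)
  rw [hpq] at hXa
  have hmem : X q ∈ Metric.closedBall a r := by
    refine Metric.isClosed_closedBall.mem_of_frequently_of_tendsto (hfreq.mono ?_) hXa
    rintro n ⟨h1, h2, h3⟩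
    rw [dist_eq_norm] at h1
    rw [Metric.mem_closedBall, dist_eq_norm]
    -- Otherwise the path crosses the annulus during `[q, t]`, dissipating more than is available up
    -- to `q'`.
    by_contra! hlt
    have hsub : Icc (q : ℝ) t ⊆ Icc 0 T := Icc_subset_Icc hqI.1 ht'.2
    have hnorm : ∀ s, ‖-gradient (E s) (y n s).1 + (y n s).2‖ =
        ‖gradient (E s) (y n s).1 - (y n s).2‖ := fun s => by
      rw [neg_add_eq_sub, norm_sub_rev]
    have hcross := mul_le_integral_of_crossing (x := fun s => (y n s).1)
      (w := fun s => -gradient (E s) (y n s).1 + (y n s).2) (e := (εs n)⁻¹)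
      (inv_nonneg.2 (hε n).le) hqt.le
      (by
        refine ((((hy n).continuousOn_gradient_sub hT hE).mono hsub).neg).congr fun s _ => ?_
        simp only [Pi.neg_apply]
        abel)
      (fun s hs => (((hy n).hasDeriv s (hsub hs)).mono hsub).fst) (c := a) (r₁ := r / 2)
      (r₂ := r) (m := m) hm.le
      (fun s hs hs1 hs2 => by
        rw [hnorm]
        refine h3 s (hsub hs) ?_ _ hs1 hs2
        rw [abs_le]
        constructor <;> linarith [hs.1, hs.2])
      h1 hlt.le
    simp only [hnorm] at hcross
    rw [← (hy n).dissipation_sub hT hE hqI ht'] at hcross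
    have h5 := (hy n).dissipation_mono hT hE (hε n) ht' (projIcc 0 T hT.le (q' : ℝ)).2 htq'
    rw [hpq] at h2
    linarith
  rwa [Metric.mem_closedBall, dist_eq_norm] at hmem

end Pointwise

end CriticalEvolution

/-! ### Compactness of the lifted curves. -/

namespace CriticalEvolution

theorem ae_timeMeasure_of_ae {T : ℝ} {P : ℝ → Prop} (h : ∀ᵐ t : ℝ, P t) :
    ∀ᵐ t : Icc (0 : ℝ) T ∂timeMeasure T, P t :=
  (ae_restrict_iff_subtype measurableSet_Icc).1 (ae_restrict_of_ae h)

theorem lintegral_timeMeasure_enorm_sq {F : Type*} [NormedAddCommGroup F] {T : ℝ} (hT : 0 ≤ T)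
    {g : ℝ → F} (hg : ContinuousOn g (Icc 0 T)) :
    ∫⁻ t : Icc (0 : ℝ) T, ‖g t‖ₑ ^ 2 ∂timeMeasure T =
      ENNReal.ofReal (∫ t in (0 : ℝ)..T, ‖g t‖ ^ 2) := by
  have h1 : ∫⁻ t : Icc (0 : ℝ) T, ‖g t‖ₑ ^ 2 ∂timeMeasure T =
      ∫⁻ t in Icc 0 T, ‖g t‖ₑ ^ 2 :=
    lintegral_subtype_comap measurableSet_Icc fun t => ‖g t‖ₑ ^ 2
  have hi : IntegrableOn (fun t => ‖g t‖ ^ 2) (Icc 0 T) := (hg.norm.pow 2).integrableOn_Icc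
  rw [h1, intervalIntegral.integral_of_le hT, ← integral_Icc_eq_integral_Ioc,
    ofReal_integral_eq_lintegral_ofReal hi (Eventually.of_forall fun _ => by positivity)]
  refine lintegral_congr fun t => ?_
  rw [ENNReal.ofReal_pow (norm_nonneg _), ofReal_norm]

variable {d : ℕ} {T : ℝ} {E : ℝ → Vec d → ℝ} {f : Vec d → Vec d}

theorem exists_lintegral_force_le (hT : 0 < T) (hE : IsAdmissibleEnergy T E)
    (hf : IsAdmissibleDrift f) (ρ : ℝ) :
    ∃ C, 0 ≤ C ∧ ∀ (ε : ℝ) (z : Vec d × Vec d) (y : ℝ → Vec d × Vec d), 0 < ε → ‖z‖ ≤ ρ →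
      IsTrajectory T E f ε z y →
      ∫⁻ t : Icc (0 : ℝ) T, ‖gradient (E t) (y t).1 - (y t).2‖ₑ ^ 2 ∂timeMeasure T ≤
        ENNReal.ofReal (C * ε) := by
  obtain ⟨C, hC0, hC⟩ := exists_dissipation_bound hT hE hf ρ
  refine ⟨C, hC0, fun ε z y hε hz hy => ?_⟩
  rw [lintegral_timeMeasure_enorm_sq (g := fun t => gradient (E t) (y t).1 - (y t).2) hT.le
    (hy.continuousOn_gradient_sub hT hE)]
  exact ENNReal.ofReal_le_ofReal (hC ε z y hε hz hy)

section Compactness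

variable {εs : ℕ → ℝ} {z : ℕ → Vec d × Vec d} {y : ℕ → ℝ → Vec d × Vec d} {ρ : ℝ}

/-- The dissipation bound makes the squared force vanish in `L¹`, hence in measure, hence almost
everywhere along a subsequence. -/
theorem exists_subseq_force_tendsto_ae (hT : 0 < T) (hE : IsAdmissibleEnergy T E)
    (hf : IsAdmissibleDrift f) (hε : ∀ n, 0 < εs n) (hε0 : Tendsto εs atTop (𝓝 0))
    (hz : ∀ n, ‖z n‖ ≤ ρ) (hy : ∀ n, IsTrajectory T E f (εs n) (z n) (y n)) :
    ∃ φ : ℕ → ℕ, StrictMono φ ∧ ∀ᵐ t : Icc (0 : ℝ) T ∂timeMeasure T,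
      Tendsto (fun n => gradient (E t) (y (φ n) t).1 - (y (φ n) t).2) atTop (𝓝 0) := by
  obtain ⟨C, hC0, hC⟩ := exists_lintegral_force_le hT hE hf ρ
  set w : ℕ → Icc (0 : ℝ) T → Vec d := fun n t => gradient (E t) (y n t).1 - (y n t).2
  have hwc : ∀ n, Continuous (w n) := fun n =>
    continuousOn_iff_continuous_domRestrict.1 ((hy n).continuousOn_gradient_sub hT hE)
  have hlim : Tendsto (fun n => ENNReal.ofReal (C * εs n)) atTop (𝓝 0) := by
    have := (ENNReal.continuous_ofReal.tendsto _).comp (hε0.const_mul C)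
    simpa using! this
  have hm : TendstoInMeasure (timeMeasure T) (fun n t => ‖w n t‖ ^ 2) atTop fun _ => (0 : ℝ) := by
    refine tendstoInMeasure_of_tendsto_eLpNorm one_ne_zero
      (fun n => ((hwc n).norm.pow 2).aestronglyMeasurable) aestronglyMeasurable_const ?_
    refine tendsto_of_tendsto_of_tendsto_of_le_of_le tendsto_const_nhds hlim (fun _ => zero_le)
      fun n => ?_
    rw [eLpNorm_one_eq_lintegral_enorm]
    refine le_trans (le_of_eq (lintegral_congr fun t => ?_))
      (hC (εs n) (z n) (y n) (hε n) (hz n) (hy n))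
    simp [w]
  obtain ⟨φ, hφ, h⟩ := hm.exists_seq_tendsto_ae
  refine ⟨φ, hφ, h.mono fun t ht => ?_⟩
  rw [tendsto_zero_iff_norm_tendsto_zero]
  have := (Real.continuous_sqrt.tendsto _).comp ht
  simpa [Function.comp_def, w] using this

/-- Pathwise compactness: along a subsequence the states converge at almost every time. -/
theorem exists_subseq_state_tendsto_ae (hT : 0 < T) (hE : IsAdmissibleEnergy T E)
    (hf : IsAdmissibleDrift f) (hε : ∀ n, 0 < εs n) (hε0 : Tendsto εs atTop (𝓝 0))
    (hz : ∀ n, ‖z n‖ ≤ ρ) (hy : ∀ n, IsTrajectory T E f (εs n) (z n) (y n))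
    (hu : ∀ t ∈ Icc 0 T, ∃ v, Tendsto (fun n => (y n t).2) atTop (𝓝 v)) :
    ∃ φ : ℕ → ℕ, StrictMono φ ∧ ∀ᵐ t : Icc (0 : ℝ) T ∂timeMeasure T,
      ∃ l, Tendsto (fun n => (y (φ n) t).1) atTop (𝓝 l) := by
  obtain ⟨M, hM0, hM⟩ := exists_trajectory_bound hT hE hf ρ
  obtain ⟨C, hC0, hC⟩ := exists_dissipation_bound hT hE hf ρ
  obtain ⟨φ, hφ, hw⟩ := exists_subseq_force_tendsto_ae hT hE hf hε hε0 hz hy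
  have h00 : (0 : ℝ) ∈ Icc 0 T := ⟨le_rfl, hT.le⟩
  have hTT : T ∈ Icc 0 T := ⟨hT.le, le_rfl⟩
  have hV0 : ∀ n, ∀ t ∈ Icc 0 T, dissipation E (εs n) (y n) t ∈ Icc 0 C := by
    intro n t ht
    constructor
    · have := (hy n).dissipation_mono hT hE (hε n) h00 ht ht.1
      simpa [dissipation] using this
    · refine ((hy n).dissipation_mono hT hE (hε n) ht hTT ht.2).trans ?_
      rw [dissipation, inv_mul_le_iff₀ (hε n), mul_comm]
      exact hC _ _ _ (hε n) (hz n) (hy n)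
  -- A countable product of compact sets replaces a diagonal argument; projecting onto `[0,T]`
  -- allows all rationals as indices.
  have hcpt : IsCompact (univ.pi fun _ : ℚ =>
      Metric.closedBall (0 : Vec d) M ×ˢ Icc (0 : ℝ) C) :=
    isCompact_univ_pi fun _ => (isCompact_closedBall _ _).prod isCompact_Icc
  obtain ⟨XV, hXVmem, ψ, hψ, hXV⟩ := hcpt.tendsto_subseq
    (x := fun n (q : ℚ) => ((y (φ n) (projIcc 0 T hT.le q)).1,
      dissipation E (εs (φ n)) (y (φ n)) (projIcc 0 T hT.le q)))
    (fun n q _ => ⟨by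
      simpa using (norm_fst_le _).trans
        (hM _ _ _ (hε (φ n)) (hz _) (hy _) (projIcc 0 T hT.le (q : ℝ)) (Subtype.mem _)).1,
      hV0 _ _ (Subtype.mem _)⟩)
  rw [tendsto_pi_nhds] at hXV
  have hX : ∀ q : ℚ, Tendsto (fun n => (y (φ (ψ n)) (projIcc 0 T hT.le q)).1) atTop
    (𝓝 (XV q).1) := fun q => (continuous_fst.tendsto _).comp (hXV q)
  have hV : ∀ q : ℚ, Tendsto (fun n => dissipation E (εs (φ (ψ n))) (y (φ (ψ n)))
    (projIcc 0 T hT.le q)) atTop (𝓝 (XV q).2) := fun q => (continuous_snd.tendsto _).comp (hXV q)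
  have hVm : Monotone fun q => (XV q).2 := fun q q' hqq => le_of_tendsto_of_tendsto' (hV q) (hV q')
    fun n => (hy _).dissipation_mono hT hE (hε _) (Subtype.mem _) (Subtype.mem _)
      (monotone_projIcc hT.le (by exact_mod_cast hqq))
  have hjump := (countable_rat_jumps hVm fun q => (hXVmem q (mem_univ q)).2.2)
  refine ⟨φ ∘ ψ, hφ.comp hψ, ?_⟩
  filter_upwards [hw, ae_timeMeasure_of_ae (hjump.ae_notMem volume),
    ae_timeMeasure_of_ae ((countable_singleton (0 : ℝ)).ae_notMem volume),
    ae_timeMeasure_of_ae ((countable_singleton T).ae_notMem volume)] with t htw htj ht0 htT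
  have ht : (t : ℝ) ∈ Ioo 0 T :=
    ⟨lt_of_le_of_ne t.2.1 (Ne.symm ht0), lt_of_le_of_ne t.2.2 htT⟩
  obtain ⟨v, hv⟩ := hu t t.2
  have hφψ := (hφ.comp hψ).tendsto_atTop
  rw [not_not] at htj
  have key := fun a ha r hr => left_limit_of_mapClusterPt (a := a) (r := r) hT hE
    (fun n => hε (φ (ψ n))) (fun n => hy (φ (ψ n)))
    (fun n t ht => (hM _ _ _ (hε (φ (ψ n))) (hz _) (hy _) t ht).2) hVm hX hV ht htj
    (hv.comp hφψ) (htw.comp hψ.tendsto_atTop) ha hr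
  have hbd : ∀ n, (y (φ (ψ n)) t).1 ∈ Metric.closedBall (0 : Vec d) M := fun n => by
    simpa using (norm_fst_le _).trans (hM _ _ _ (hε (φ (ψ n))) (hz _) (hy _) t t.2).1
  obtain ⟨a, -, ha⟩ := (isCompact_closedBall (0 : Vec d) M).exists_mapClusterPt
    (f := atTop) (u := fun n => (y (φ (ψ n)) t).1) (by
      rw [le_principal_iff, mem_map]
      exact Eventually.of_forall hbd)
  refine ⟨a, (isCompact_closedBall (0 : Vec d) M).le_nhds_of_unique_clusterPt
    (mem_map.2 (Eventually.of_forall hbd)) fun b _ hb => ?_⟩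
  -- Two cluster points are both close to the limit state at one rational time just before `t`.
  refine eq_of_forall_dist_le fun r hr => ?_
  obtain ⟨s, hs, h1⟩ := key a ha (r / 2) (half_pos hr)
  obtain ⟨s', hs', h2⟩ := key b hb (r / 2) (half_pos hr)
  obtain ⟨q, hq1, hq2⟩ := exists_rat_btwn (max_lt hs hs')
  have h3 := h1 q ((le_max_left _ _).trans_lt hq1) hq2
  have h4 := h2 q ((le_max_right _ _).trans_lt hq1) hq2
  rw [← dist_eq_norm] at h3 h4
  linarith [dist_triangle_left b a (XV q).1]

/-- Vitali's theorem on a finite measure space: a uniform bound gives uniform integrability, as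
truncating above the bound leaves nothing. -/
theorem tendsto_toLp_of_tendsto_ae {α F : Type*} [TopologicalSpace α] [CompactSpace α]
    [MeasurableSpace α] [BorelSpace α] [NormedAddCommGroup F] [NormedSpace ℝ F]
    [SecondCountableTopologyEither α F]
    {μ : Measure α} [IsFiniteMeasure μ] {p : ℝ≥0∞} [Fact (1 ≤ p)] (hp : p ≠ ∞) {x : ℕ → C(α, F)}
    {M : ℝ} (hM : ∀ n t, ‖x n t‖ ≤ M)
    (hx : ∀ᵐ t ∂μ, ∃ l, Tendsto (fun n => x n t) atTop (𝓝 l)) :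
    ∃ X : Lp F p μ, Tendsto (fun n => ContinuousMap.toLp (E := F) p μ ℝ (x n)) atTop (𝓝 X) := by
  have hxm : ∀ n, AEStronglyMeasurable (x n) μ := fun n =>
    (x n).continuous.aestronglyMeasurable
  obtain ⟨g, hgm, hg⟩ := exists_stronglyMeasurable_limit_of_tendsto_ae hxm hx
  have hgL : MemLp g p μ := MemLp.of_bound hgm.aestronglyMeasurable M <| hg.mono fun t ht =>
    le_of_tendsto' ht.norm fun n => hM n t
  refine ⟨hgL.toLp g, (Lp.tendsto_Lp_iff_tendsto_eLpNorm _ g hgL).2 ?_⟩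
  have hui : UnifIntegrable (fun n => (x n : α → F)) p μ := by
    refine unifIntegrable_of Fact.out hp hxm fun ε hε => ⟨M.toNNReal + 1, fun n => ?_⟩
    have : {t | M.toNNReal + 1 ≤ ‖x n t‖₊} = ∅ := by
      refine eq_empty_of_forall_notMem fun t (ht : M.toNNReal + 1 ≤ ‖x n t‖₊) => ?_
      have h1 : ((M.toNNReal + 1 : ℝ≥0) : ℝ) ≤ ‖x n t‖ := by exact_mod_cast ht
      have h2 := hM n t
      have h3 := Real.le_coe_toNNReal M
      push_cast at h1
      linarith
    simp [this]
  refine (tendsto_Lp_finite_of_tendsto_ae Fact.out hp hxm hgL hui hg).congr fun n =>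
    eLpNorm_congr_ae ?_
  exact ((ContinuousMap.coeFn_toLp (p := p) (𝕜 := ℝ) μ (x n)).sub (EventuallyEq.refl _ _)).symm

end Compactness

/-- The control equation is autonomous and free of `ε`, so controls for different parameters are
compared by one Gronwall constant. -/
theorem exists_dist_controlCurve_le (hT : 0 < T) (hE : IsAdmissibleEnergy T E)
    (hf : IsAdmissibleDrift f) (ρ : ℝ) :
    ∃ L : ℝ, 0 ≤ L ∧ ∀ (ε ε' : ℝ) (z z' : Vec d × Vec d), 0 < ε → 0 < ε' → ‖z‖ ≤ ρ → ‖z'‖ ≤ ρ →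
      dist (controlCurve T E f ε z) (controlCurve T E f ε' z') ≤ L * dist z z' := by
  obtain ⟨M, hM0, hM⟩ := exists_trajectory_bound hT hE hf ρ
  obtain ⟨K, hK⟩ := hf.exists_lipschitzOnWith M
  refine ⟨Real.exp (K * T), (Real.exp_pos _).le, fun ε ε' z z' hε hε' hz hz' => ?_⟩
  have h := isTrajectory_flow hT hE hf hε z
  have h' := isTrajectory_flow hT hE hf hε' z'
  refine (ContinuousMap.dist_le (by positivity)).2 fun t => ?_
  have hder : ∀ {e : ℝ} {w : Vec d × Vec d}, IsTrajectory T E f e w (flow T E f e w) →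
      ∀ t ∈ Ico 0 T, HasDerivWithinAt (fun s => (flow T E f e w s).2)
        (f (flow T E f e w t).2) (Ici t) t :=
    fun hw t ht => ((hw.hasDeriv t (Ico_subset_Icc_self ht)).mono_of_mem_nhdsWithin
      (Icc_mem_nhdsGE_of_mem ht)).snd
  have hmem : ∀ {e : ℝ} {w : Vec d × Vec d}, 0 < e → ‖w‖ ≤ ρ →
      IsTrajectory T E f e w (flow T E f e w) →
      ∀ t ∈ Ico 0 T, (flow T E f e w t).2 ∈ Metric.closedBall (0 : Vec d) M :=
    fun he hw hw' t ht => by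
      simpa using (norm_snd_le _).trans (hM _ _ _ he hw hw' t (Ico_subset_Icc_self ht)).1
  have := dist_le_of_trajectories_ODE_of_mem (v := fun _ => f)
    (s := fun _ => Metric.closedBall (0 : Vec d) M) (K := K) (δ := dist z z')
    (fun t _ => hK) h.continuousOn.snd (hder h) (hmem hε hz h) h'.continuousOn.snd (hder h')
    (hmem hε' hz' h') (by rw [h.initial, h'.initial]; exact le_max_right _ _) t t.2
  refine this.trans ?_
  rw [mul_comm, sub_zero]
  gcongr
  exact t.2.2

/-- Sequences of lifted initial data with vanishing `ε` are relatively compact. -/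
theorem exists_subseq_liftMap_tendsto (hT : 0 < T) (hE : IsAdmissibleEnergy T E)
    (hf : IsAdmissibleDrift f) {p : ℝ≥0∞} [Fact (1 ≤ p)] (hp : p ≠ ∞)
    {K : Set (Vec d × Vec d)} (hK : IsCompact K) {εs : ℕ → ℝ} (hε : ∀ n, 0 < εs n)
    (hε0 : Tendsto εs atTop (𝓝 0)) {z : ℕ → Vec d × Vec d} (hz : ∀ n, z n ∈ K) :
    ∃ (w : PathSpace d T p) (φ : ℕ → ℕ), StrictMono φ ∧
      Tendsto (fun n => liftMap T p E f (εs (φ n)) (z (φ n))) atTop (𝓝 w) := by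
  obtain ⟨ρ, hρ⟩ := hK.isBounded.exists_norm_le
  obtain ⟨z₀, -, φ, hφ, hφz⟩ := hK.tendsto_subseq hz
  obtain ⟨L, hL0, hL⟩ := exists_dist_controlCurve_le hT hE hf ρ
  obtain ⟨M, hM0, hM⟩ := exists_trajectory_bound hT hE hf ρ
  have hcau : CauchySeq fun n => controlCurve T E f (εs (φ n)) (z (φ n)) := by
    refine Metric.cauchySeq_iff.2 fun δ hδ => ?_
    obtain ⟨N, hN⟩ := Metric.cauchySeq_iff.1 hφz.cauchySeq (δ / (L + 1)) (by positivity)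
    refine ⟨N, fun m hm n hn => (hL _ _ _ _ (hε _) (hε _) (hρ _ (hz _)) (hρ _ (hz _))).trans_lt ?_⟩
    have := hN m hm n hn
    rw [lt_div_iff₀ (by positivity)] at this
    simp only [Function.comp_apply] at this
    nlinarith [dist_nonneg (x := z (φ m)) (y := z (φ n))]
  obtain ⟨u, hu⟩ := cauchySeq_tendsto_of_complete hcau
  obtain ⟨ψ, hψ, hx⟩ := exists_subseq_state_tendsto_ae hT hE hf (fun n => hε (φ n))
    (hε0.comp hφ.tendsto_atTop) (fun n => hρ _ (hz (φ n)))
    (fun n => isTrajectory_flow hT hE hf (hε (φ n)) (z (φ n)))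
    (fun t ht => ⟨u ⟨t, ht⟩, ((ContinuousEvalConst.continuous_eval_const
      (⟨t, ht⟩ : Icc (0 : ℝ) T)).tendsto u).comp hu⟩)
  obtain ⟨X, hX⟩ := tendsto_toLp_of_tendsto_ae (p := p) hp
    (x := fun n => stateCurve T E f (εs (φ (ψ n))) (z (φ (ψ n)))) (M := M)
    (fun n t => (norm_fst_le _).trans (hM _ _ _ (hε _) (hρ _ (hz _))
      (isTrajectory_flow hT hE hf (hε _) _) t t.2).1) hx
  refine ⟨(z₀.1, z₀.2, X, u), φ ∘ ψ, hφ.comp hψ, ?_⟩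
  have hz0 := hφz.comp hψ.tendsto_atTop
  exact ((continuous_fst.tendsto _).comp hz0).prodMk_nhds
    (((continuous_snd.tendsto _).comp hz0).prodMk_nhds
      (hX.prodMk_nhds (hu.comp hψ.tendsto_atTop)))

/-- The lifts of a compact set of initial data along a vanishing sequence of parameters lie in a
compact set of paths. -/
theorem isCompact_closure_iUnion_liftMap (hT : 0 < T) (hE : IsAdmissibleEnergy T E)
    (hf : IsAdmissibleDrift f) {p : ℝ≥0∞} [Fact (1 ≤ p)] (hp : p ≠ ∞)
    {K : Set (Vec d × Vec d)} (hK : IsCompact K) {εs : ℕ → ℝ} (hε : ∀ n, 0 < εs n)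
    (hε0 : Tendsto εs atTop (𝓝 0)) :
    IsCompact (closure (⋃ n, liftMap T p E f (εs n) '' K)) := by
  set S := ⋃ n, liftMap T p E f (εs n) '' K
  have hS : ∀ s : ℕ → PathSpace d T p, (∀ k, s k ∈ S) →
      ∃ (w : PathSpace d T p) (φ : ℕ → ℕ), StrictMono φ ∧ Tendsto (s ∘ φ) atTop (𝓝 w) := by
    intro s hs
    choose n z hz hzs using fun k => mem_iUnion.1 (hs k)
    -- Either some index recurs, and continuity of that single lift suffices, or the indices tend to
    -- infinity and the parameters vanish.
    by_cases h : ∃ N, ∃ᶠ k in atTop, n k = N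
    · obtain ⟨N, hN⟩ := h
      obtain ⟨φ, hφ, hφN⟩ := extraction_of_frequently_atTop hN
      obtain ⟨z₀, -, ψ, hψ, hψz⟩ := hK.tendsto_subseq fun k => hz (φ k)
      refine ⟨liftMap T p E f (εs N) z₀, φ ∘ ψ, hφ.comp hψ, ?_⟩
      refine (((continuous_liftMap hT hE hf p (hε N)).tendsto z₀).comp hψz).congr fun k => ?_
      simp only [Function.comp_apply]
      rw [← hzs, hφN]
    · have hn : Tendsto n atTop atTop := by
        push Not at h
        refine le_trans (le_cofinite_iff_eventually_ne.2 fun N => ?_) Nat.cofinite_eq_atTop.le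
        exact h N
      obtain ⟨w, φ, hφ, hw⟩ := exists_subseq_liftMap_tendsto hT hE hf hp hK
        (fun k => hε (n k)) (hε0.comp hn) hz
      exact ⟨w, φ, hφ, hw.congr fun k => hzs (φ k)⟩
  refine IsSeqCompact.isCompact fun c hc => ?_
  -- Points of the closure are approximated within `1 / (k + 1)` by points of `S`, which have the
  -- same subsequential limits.
  have hpos : ∀ k : ℕ, (0 : ℝ) < 1 / (k + 1) := fun k => Nat.one_div_pos_of_nat
  choose s hs hsc using fun k => Metric.mem_closure_iff.1 (hc k) _ (hpos k)
  obtain ⟨w, φ, hφ, hw⟩ := hS s hs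
  have hcs : Tendsto (fun k => dist ((s ∘ φ) k) ((c ∘ φ) k)) atTop (𝓝 0) := by
    refine squeeze_zero (fun _ => dist_nonneg) (fun k => ?_)
      (tendsto_one_div_add_atTop_nhds_zero_nat.comp hφ.tendsto_atTop)
    rw [dist_comm]
    exact (hsc (φ k)).le
  have hcw := (tendsto_iff_of_dist hcs).1 hw
  exact ⟨w, mem_closure_of_tendsto hw (Eventually.of_forall fun k => hs _), φ, hφ, hcw⟩

end CriticalEvolution

/-! ### The critical defect and passage to the limit. -/

namespace CriticalEvolution

variable {d : ℕ} {T : ℝ} {E : ℝ → Vec d → ℝ} {f : Vec d → Vec d}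

/-- The squared `L²` distance of a path from the critical set. -/
noncomputable def criticalDefect (T : ℝ) (E : ℝ → Vec d → ℝ) {p : ℝ≥0∞} (w : PathSpace d T p) :
    ℝ≥0∞ :=
  ∫⁻ t : Icc (0 : ℝ) T, ‖gradient (E t) (w.2.2.1 t) - w.2.2.2 t‖ₑ ^ 2 ∂timeMeasure T

theorem continuous_gradient_subtype (hT : 0 < T) (hE : IsAdmissibleEnergy T E) :
    Continuous fun q : Icc (0 : ℝ) T × Vec d => gradient (E q.1) q.2 :=
  continuousOn_univ.1 <| (hE.continuousOn_gradient hT).comp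
    (f := fun q : Icc (0 : ℝ) T × Vec d => ((q.1 : ℝ), q.2)) (by fun_prop)
    fun q _ => ⟨q.1.2, mem_univ _⟩

/-- The defect is lower semicontinuous by Fatou, after passing to an almost everywhere convergent
subsequence. No growth bound on the gradient is available, so continuity is not claimed. -/
theorem isClosed_criticalDefect_le (hT : 0 < T) (hE : IsAdmissibleEnergy T E) {p : ℝ≥0∞}
    [Fact (1 ≤ p)] (c : ℝ≥0∞) : IsClosed {w : PathSpace d T p | criticalDefect T E w ≤ c} := by
  refine IsSeqClosed.isClosed fun s w hs hsw => ?_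
  have h2 := (continuous_snd.tendsto _).comp ((continuous_snd.tendsto _).comp hsw)
  have hx : Tendsto (fun n => (s n).2.2.1) atTop (𝓝 w.2.2.1) := (continuous_fst.tendsto _).comp h2
  have hu : Tendsto (fun n => (s n).2.2.2) atTop (𝓝 w.2.2.2) := (continuous_snd.tendsto _).comp h2
  obtain ⟨φ, hφ, hφx⟩ := (tendstoInMeasure_of_tendsto_Lp hx).exists_seq_tendsto_ae
  have hG := continuous_gradient_subtype hT hE
  have hmeas : ∀ n, AEMeasurable (fun t : Icc (0 : ℝ) T =>
      ‖gradient (E t) ((s (φ n)).2.2.1 t) - (s (φ n)).2.2.2 t‖ₑ ^ 2) (timeMeasure T) := fun n =>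
    (((hG.comp_aestronglyMeasurable (continuous_id.aestronglyMeasurable.prodMk
      (Lp.aestronglyMeasurable (s (φ n)).2.2.1))).sub
      (s (φ n)).2.2.2.continuous.aestronglyMeasurable).enorm).pow_const 2
  have hle : criticalDefect T E w ≤ liminf (fun n => criticalDefect T E (s (φ n))) atTop := by
    refine le_trans (lintegral_mono_ae ?_) (lintegral_liminf_le' hmeas)
    filter_upwards [hφx] with t ht
    have h3 : Tendsto (fun n => gradient (E t) ((s (φ n)).2.2.1 t)) atTop
        (𝓝 (gradient (E t) (w.2.2.1 t))) :=
      (hG.tendsto (t, w.2.2.1 t)).comp (tendsto_const_nhds.prodMk_nhds ht)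
    have h4 : Tendsto (fun n => (s (φ n)).2.2.2 t) atTop (𝓝 (w.2.2.2 t)) :=
      ((ContinuousEvalConst.continuous_eval_const t).tendsto _).comp (hu.comp hφ.tendsto_atTop)
    exact ((ENNReal.continuous_pow 2).tendsto _ |>.comp (h3.sub h4).enorm).liminf_eq.ge
  refine hle.trans ?_
  exact (liminf_le_liminf (Eventually.of_forall fun n => hs (φ n))).trans_eq (liminf_const c)

theorem exists_criticalDefect_liftMap_le (hT : 0 < T) (hE : IsAdmissibleEnergy T E)
    (hf : IsAdmissibleDrift f) {p : ℝ≥0∞} [Fact (1 ≤ p)] {K : Set (Vec d × Vec d)}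
    (hK : IsCompact K) :
    ∃ C, 0 ≤ C ∧ ∀ ε, 0 < ε → ∀ z ∈ K,
      criticalDefect T E (liftMap T p E f ε z) ≤ ENNReal.ofReal (C * ε) := by
  obtain ⟨ρ, hρ⟩ := hK.isBounded.exists_norm_le
  obtain ⟨C, hC0, hC⟩ := exists_lintegral_force_le hT hE hf ρ
  refine ⟨C, hC0, fun ε hε z hz => ?_⟩
  refine le_trans (le_of_eq (lintegral_congr_ae ?_))
    (hC ε z _ hε (hρ z hz) (isTrajectory_flow hT hE hf hε z))
  filter_upwards [ContinuousMap.coeFn_toLp (p := p) (𝕜 := ℝ) (timeMeasure T)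
    (stateCurve T E f ε z)] with t ht
  simp only [liftMap]
  rw [ht]
  rfl

theorem isProbabilityMeasure_liftMeasure (hT : 0 < T) (hE : IsAdmissibleEnergy T E)
    (hf : IsAdmissibleDrift f) (p : ℝ≥0∞) [Fact (1 ≤ p)] (η₀ : Measure (Vec d × Vec d))
    [IsProbabilityMeasure η₀] {ε : ℝ} (hε : 0 < ε) :
    IsProbabilityMeasure (liftMeasure T p E f η₀ ε) :=
  Measure.isProbabilityMeasure_map (continuous_liftMap hT hE hf p hε).measurable.aemeasurable

theorem liftMeasure_compl_eq_zero (hT : 0 < T) (hE : IsAdmissibleEnergy T E)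
    (hf : IsAdmissibleDrift f) {p : ℝ≥0∞} [Fact (1 ≤ p)] {η₀ : Measure (Vec d × Vec d)}
    {K : Set (Vec d × Vec d)} (hK : η₀ Kᶜ = 0) {ε : ℝ} (hε : 0 < ε) {A : Set (PathSpace d T p)}
    (hA : IsClosed A) (hKA : ∀ z ∈ K, liftMap T p E f ε z ∈ A) :
    liftMeasure T p E f η₀ ε Aᶜ = 0 := by
  rw [liftMeasure, Measure.map_apply (continuous_liftMap hT hE hf p hε).measurable
    hA.measurableSet.compl]
  exact measure_mono_null (fun z hz hzK => hz (hKA z hzK)) hK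

end CriticalEvolution

theorem theorem3p4 (d : ℕ) (T : ℝ) (hT : 0 < T)
    (E : ℝ → Vec d → ℝ) (hE : IsAdmissibleEnergy T E)
    (f : Vec d → Vec d) (hf : IsAdmissibleDrift f)
    (p : ℝ≥0∞) [Fact (1 ≤ p)] (hp : p ≠ ∞)
    (η₀ : ProbabilityMeasure (Vec d × Vec d))
    (hη₀ : ∃ K : Set (Vec d × Vec d), IsCompact K ∧ (η₀ : Measure (Vec d × Vec d)) Kᶜ = 0) :
    ∃ P : ℝ → ProbabilityMeasure (PathSpace d T p),
      (∀ ε : ℝ, 0 < ε →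
        (P ε : Measure (PathSpace d T p)) = liftMeasure T p E f (η₀ : Measure (Vec d × Vec d)) ε) ∧
      (∀ εs : ℕ → ℝ, (∀ n, 0 < εs n) → Tendsto εs atTop (𝓝 0) →
        ∃ (Q : ProbabilityMeasure (PathSpace d T p)) (k : ℕ → ℕ), StrictMono k ∧
          Tendsto (fun n => P (εs (k n))) atTop (𝓝 Q)) ∧
      (∀ Q : ProbabilityMeasure (PathSpace d T p), MapClusterPt Q (𝓝[>] (0 : ℝ)) P →
        ∫⁻ w : PathSpace d T p,
          (∫⁻ t : Icc (0 : ℝ) T, ‖gradient (E t) (w.2.2.1 t) - w.2.2.2 t‖ₑ ^ 2 ∂(timeMeasure T))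
          ∂(Q : Measure (PathSpace d T p)) = 0) := by
  obtain ⟨K, hK, hK0⟩ := hη₀
  -- Nonpositive parameters get the lift at parameter `1`, only to make `P` total; the filter `𝓝[>]
  -- 0` ignores them.
  have hpos : ∀ ε : ℝ, 0 < if 0 < ε then ε else 1 := fun ε => by split_ifs <;> simp_all
  set P : ℝ → ProbabilityMeasure (PathSpace d T p) := fun ε =>
    ⟨liftMeasure T p E f η₀ (if 0 < ε then ε else 1),
      isProbabilityMeasure_liftMeasure hT hE hf p η₀ (hpos ε)⟩
  have hP : ∀ ε : ℝ, 0 < ε → (P ε : Measure (PathSpace d T p)) = liftMeasure T p E f η₀ ε :=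
    fun ε hε => by simp [P, hε]
  refine ⟨P, hP, fun εs hε hε0 => ?_, fun Q hQ => ?_⟩
  · have : Fact (p ≠ ∞) := ⟨hp⟩
    have htight : IsTightMeasureSet
        {((μ : ProbabilityMeasure (PathSpace d T p)) : Measure (PathSpace d T p)) |
          μ ∈ range fun n => P (εs n)} := by
      refine isTightMeasureSet_iff_exists_isCompact_measure_compl_le.2 fun δ _ =>
        ⟨_, isCompact_closure_iUnion_liftMap hT hE hf hp hK hε hε0, ?_⟩
      rintro _ ⟨_, ⟨n, rfl⟩, rfl⟩
      have hmem : ∀ z ∈ K, liftMap T p E f (εs n) z ∈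
          closure (⋃ n, liftMap T p E f (εs n) '' K) :=
        fun z hz => subset_closure (mem_iUnion.2 ⟨n, z, hz, rfl⟩)
      rw [hP _ (hε n), liftMeasure_compl_eq_zero hT hE hf hK0 (hε n) isClosed_closure hmem]
      exact zero_le
    obtain ⟨Q, -, k, hk, hkQ⟩ := (isCompact_closure_of_isTightMeasureSet htight).tendsto_subseq
      fun n => subset_closure (mem_range_self n)
    exact ⟨Q, k, hk, hkQ⟩
  · obtain ⟨C, hC0, hC⟩ := exists_criticalDefect_liftMap_le (p := p) hT hE hf hK
    -- An ultrafilter turns the cluster point into a limit, so the portmanteau inequality applies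
    -- without extracting a sequence.
    obtain ⟨U, hU, hUQ⟩ := mapClusterPt_iff_ultrafilter.1 hQ
    have hlim : Tendsto (fun ε => ENNReal.ofReal (C * ε)) (𝓝[>] (0 : ℝ)) (𝓝 0) := by
      have : Tendsto (fun ε : ℝ => ENNReal.ofReal (C * ε)) (𝓝 0) (𝓝 (ENNReal.ofReal (C * 0))) :=
        (ENNReal.continuous_ofReal.comp (continuous_const_mul C)).tendsto 0
      rw [mul_zero, ENNReal.ofReal_zero] at this
      exact this.mono_left nhdsWithin_le_nhds
    have hae : ∀ c : ℝ≥0∞, 0 < c →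
        ∀ᵐ w ∂(Q : Measure (PathSpace d T p)), criticalDefect T E w ≤ c := by
      intro c hc
      have hcl := isClosed_criticalDefect_le (p := p) hT hE c
      have hev : ∀ᶠ ε in (U : Filter ℝ),
          (P ε : Measure (PathSpace d T p)) {w | criticalDefect T E w ≤ c} = 1 := by
        filter_upwards [hU self_mem_nhdsWithin, hU (hlim.eventually_lt_const hc)] with ε hε hεc
        rw [← prob_compl_eq_zero_iff hcl.measurableSet, hP ε hε]
        exact liftMeasure_compl_eq_zero hT hE hf hK0 hε hcl
          fun z hz => (hC ε hε z hz).trans hεc.le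
      have hle := ProbabilityMeasure.limsup_measure_closed_le_of_tendsto hUQ hcl
      rw [limsup_congr hev, limsup_const] at hle
      rw [ae_iff]
      exact (prob_compl_eq_zero_iff hcl.measurableSet).2 (le_antisymm prob_le_one hle)
    have hzero : ∀ᵐ w ∂(Q : Measure (PathSpace d T p)), criticalDefect T E w = 0 := by
      have := ae_all_iff.2 fun n : ℕ => hae ((n : ℝ≥0∞) + 1)⁻¹ (by simp)
      filter_upwards [this] with w hw
      have hinv : Tendsto (fun n : ℕ => ((n : ℝ≥0∞) + 1)⁻¹) atTop (𝓝 0) := by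
        simpa using! (tendsto_add_atTop_iff_nat 1).2 ENNReal.tendsto_inv_nat_nhds_zero
      exact le_antisymm (ge_of_tendsto' hinv hw) zero_le
    exact (lintegral_congr_ae hzero).trans lintegral_zero
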